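/- Conventions. Manifolds are smooth, finite-dimensional, without boundary, Hausdorff, second countable and non-empty. A Lie algebroid $(E,\rho_E,[\cdot,\cdot]_E)$ over $M$ is a smooth real vector bundle $E\to M$ of finite rank with a smooth vector bundle map $\rho_E:E\to TM$ (the anchor) and a Lie bracket $[\cdot,\cdot]_E$ on $\Gamma(E)$ such that $[s,ft]_E=f[s,t]_E+\rho_E(s)(f)\,t$ for all $s,t\in\Gamma(E)$, $f\in C^\infty(M)$. For a $1$-form section $\eta\in\Gamma(E^*)$ put $$2\,d_E\eta(s,t)=\rho_E(s)(\eta(t))-\rho_E(t)(\eta(s))-\eta([s,t]_E),$$ and for $A\in\Gamma(E\otimes E^*)$ let $N_A(s,t)=[As,At]_E-A[As,t]_E-A[s,At]_E+A^2[s,t]_E$. An almost contact Riemannian structure on $E$, of rank $2m+1$, consists of $F_E\in\Gamma(E\otimes E^*)$, $\xi\in\Gamma(E)$, $\eta\in\Gamma(E^*)$ and a Riemannian metric $g_E$ on $E$ with $$F_E^2=-I_E+\eta\otimes\xi,\qquad \eta(\xi)=1,\qquad g_E(F_Es,F_Et)=g_E(s,t)-\eta(s)\eta(t).$$ It is normal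 if $N_{F_E}+2\,d_E\eta\otimes\xi=0$. An almost Hermitian structure on $E$ is a pair $(J,g)$ of $J\in\Gamma(E\otimes E^*)$ with $J^2=-I_E$ and a Riemannian metric $g$ on $E$ with $g(Js,Jt)=g(s,t)$; it is Hermitian if moreover $N_J=0$. The direct product of Lie algebroids $E_1\to M_1$ and $E_2\to M_2$ is the vector bundle $E=E_1\times E_2\to M_1\times M_2$ with anchor $\rho_{E_1}\times\rho_{E_2}$ and the following bracket. Write sections of $E$ as $s=(s_1,s_2)$, $t=(t_1,t_2)$ with $s_i(x,y),t_i(x,y)$ in the fibre of $E_1$ at $x$ for $i=1$ and of $E_2$ at $y$ for $i=2$. The first component of $[s,t]_E$ at $(x,y)$ is $$[s_1(\cdot,y),t_1(\cdot,y)]_{E_1}(x)+\partial_{\rho_{E_2}(s_2(x,y))}\,t_1(x,\cdot)-\partial_{\rho_{E_2}(t_2(x,y))}\,s_1(x,\cdot),$$ where $\partial_w$ is the derivative at $y$, in the direction $w\in T_yM_2$, of a map from $M_2$ to the fixed fibre of $E_1$ at $x$; the second component is given by the same formula with the roles of the two factors exchanged. Proposition. Let $(F_{E_i},\xi_i,\eta_i,g_{E_i})$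 be an almost contact Riemannian structure on a Lie algebroid $E_i$ of rank $2m_i+1$ over $M_i$, $i=1,2$. On the direct product $E=E_1\times E_2$ define $$F_E(v,w)=\bigl(F_{E_1}v-\eta_2(w)\,\xi_1,\ F_{E_2}w+\eta_1(v)\,\xi_2\bigr),\qquad g_E\bigl((v,w),(v',w')\bigr)=g_{E_1}(v,v')+g_{E_2}(w,w').$$ Then $(F_E,g_E)$ is an almost Hermitian structure on $E$. It is Hermitian, that is $N_{F_E}=0$, if and only if both almost contact Riemannian structures are normal. -/

import Mathlib

open scoped Manifold Bundle ContDiff Topology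

noncomputable section

section SingleBundle

variable {EM : Type*} [NormedAddCommGroup EM] [NormedSpace ℝ EM]
  {H : Type*} [TopologicalSpace H] (I : ModelWithCorners ℝ EM H)
  {M : Type*} [TopologicalSpace M] [ChartedSpace H M]
  (F : Type*) [NormedAddCommGroup F] [NormedSpace ℝ F]
  (V : M → Type*) [TopologicalSpace (Bundle.TotalSpace F V)]
  [∀ x, TopologicalSpace (V x)] [∀ x, AddCommGroup (V x)] [∀ x, Module ℝ (V x)]
  [FiberBundle F V]

variable {V} in
/-- `s` is a smooth section of the vector bundle `V`. -/
def IsSmoothSection (s : Π x, V x) : Prop :=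
  ContMDiff I (I.prod 𝓘(ℝ, F)) ∞ (fun x ↦ Bundle.TotalSpace.mk' F x (s x))

/-- The operations of a Lie algebroid on the bundle `V`, without the laws: an anchor `V → TM`, linear
on fibres, and a bracket of sections. Only the brackets of smooth sections are meaningful. -/
structure AlgebroidData where
  anchor : Π x, V x →L[ℝ] TangentSpace I x
  bracket : (Π x, V x) → (Π x, V x) → (Π x, V x)

variable {I V} in
/-- The derivative `ρ(s)(f)` of the function `f` in the direction of the anchor of `s`. -/
def AlgebroidData.anchorDeriv (A : AlgebroidData I V) (s : Π x, V x) (f : M → ℝ) (x : M) : ℝ :=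
  (mfderiv I 𝓘(ℝ, ℝ) f x (A.anchor x (s x)) : ℝ)

variable {I V} in
/-- The Nijenhuis tensor of an endomorphism `J` of the bundle, evaluated on two sections. -/
def AlgebroidData.nijenhuis (A : AlgebroidData I V) (J : Π x, V x →L[ℝ] V x)
    (s t : Π x, V x) (x : M) : V x :=
  A.bracket (fun y ↦ J y (s y)) (fun y ↦ J y (t y)) x
    - J x (A.bracket (fun y ↦ J y (s y)) t x)
    - J x (A.bracket s (fun y ↦ J y (t y)) x)
    + J x (J x (A.bracket s t x))

variable {I V} in
/-- The exterior derivative of a one-form on the algebroid, with the normalization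
`2 dη(s, t) = ρ(s)(η(t)) - ρ(t)(η(s)) - η([s, t])`. -/
def AlgebroidData.extDeriv (A : AlgebroidData I V) (η : Π x, V x →L[ℝ] ℝ)
    (s t : Π x, V x) (x : M) : ℝ :=
  (1 / 2 : ℝ) * (A.anchorDeriv s (fun y ↦ η y (t y)) x
    - A.anchorDeriv t (fun y ↦ η y (s y)) x - η x (A.bracket s t x))

variable [∀ x, IsTopologicalAddGroup (V x)] [∀ x, ContinuousSMul ℝ (V x)] [VectorBundle ℝ F V]

variable {V} in
/-- The family `J` is a smooth section of the bundle of endomorphisms of `V`. -/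
def IsSmoothEndo (J : Π x, V x →L[ℝ] V x) : Prop :=
  ContMDiff I (I.prod 𝓘(ℝ, F →L[ℝ] F)) ∞
    (fun x ↦ Bundle.TotalSpace.mk' (F →L[ℝ] F) (E := fun x ↦ V x →L[ℝ] V x) x (J x))

variable {V} in
/-- The family `η` is a smooth section of the dual bundle of `V`. -/
def IsSmoothOneForm (η : Π x, V x →L[ℝ] ℝ) : Prop :=
  ContMDiff I (I.prod 𝓘(ℝ, F →L[ℝ] ℝ)) ∞
    (fun x ↦ Bundle.TotalSpace.mk' (F →L[ℝ] ℝ) (E := fun x ↦ V x →L[ℝ] ℝ) x (η x))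

/-- A Lie algebroid structure on the smooth vector bundle `V`: a smooth anchor `V → TM` and a Lie
bracket on the smooth sections of `V`, related by the Leibniz rule. -/
structure LieAlgebroid [IsManifold I ∞ M] extends AlgebroidData I V where
  smooth_anchor : ContMDiff I (I.prod 𝓘(ℝ, F →L[ℝ] EM)) ∞
    (fun x ↦ Bundle.TotalSpace.mk' (F →L[ℝ] EM) (E := fun x ↦ V x →L[ℝ] TangentSpace I x)
      x (anchor x))
  smooth_bracket : ∀ s t, IsSmoothSection I F s → IsSmoothSection I F t →
    IsSmoothSection I F (bracket s t)
  bracket_add : ∀ s t u, IsSmoothSection I F s → IsSmoothSection I F t → IsSmoothSection I F u →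
    bracket s (t + u) = bracket s t + bracket s u
  bracket_const_smul : ∀ (c : ℝ) s t, IsSmoothSection I F s → IsSmoothSection I F t →
    bracket s (c • t) = c • bracket s t
  bracket_skew : ∀ s t, IsSmoothSection I F s → IsSmoothSection I F t →
    bracket s t = - bracket t s
  jacobi : ∀ s t u, IsSmoothSection I F s → IsSmoothSection I F t → IsSmoothSection I F u →
    bracket s (bracket t u) + bracket t (bracket u s) + bracket u (bracket s t) = 0
  leibniz : ∀ s t (f : M → ℝ), IsSmoothSection I F s → IsSmoothSection I F t →
    ContMDiff I 𝓘(ℝ, ℝ) ∞ f → ∀ x,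
    bracket s (fun y ↦ f y • t y) x
      = f x • bracket s t x + toAlgebroidData.anchorDeriv s f x • t x

/-- An almost contact Riemannian structure `(F, ξ, η, g)` on the vector bundle `V`. -/
structure AlmostContactRiemannianStructure where
  endo : Π x, V x →L[ℝ] V x
  reeb : Π x, V x
  form : Π x, V x →L[ℝ] ℝ
  metric : Bundle.ContMDiffRiemannianMetric I ∞ F V
  smooth_endo : IsSmoothEndo I F endo
  smooth_reeb : IsSmoothSection I F reeb
  smooth_form : IsSmoothOneForm I F form
  endo_endo : ∀ x (v : V x), endo x (endo x v) = - v + form x v • reeb x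
  form_reeb : ∀ x, form x (reeb x) = 1
  metric_endo : ∀ x (v w : V x),
    metric.inner x (endo x v) (endo x w) = metric.inner x v w - form x v * form x w

variable {I F V} in
/-- The almost contact structure `(F, ξ, η)` is normal: `N_F + 2 dη ⊗ ξ = 0`. -/
def AlmostContactRiemannianStructure.IsNormal
    (S : AlmostContactRiemannianStructure I F V) (A : AlgebroidData I V) : Prop :=
  ∀ s t, IsSmoothSection I F s → IsSmoothSection I F t → ∀ x,
    A.nijenhuis S.endo s t x + (2 * A.extDeriv S.form s t x) • S.reeb x = 0

variable {V} in
/-- `(J, g)` is an almost Hermitian structure on the vector bundle `V`: `J` is a smooth almost complex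
structure, `g` is a smooth Riemannian metric, and `J` is orthogonal for `g`. -/
structure IsAlmostHermitian (J : Π x, V x →L[ℝ] V x) (g : Π x, V x →L[ℝ] V x →L[ℝ] ℝ) : Prop where
  smooth_endo : IsSmoothEndo I F J
  riemannian : ∃ G : Bundle.ContMDiffRiemannianMetric I ∞ F V, ∀ x, G.inner x = g x
  endo_endo : ∀ x (v : V x), J x (J x v) = - v
  metric_endo : ∀ x (v w : V x), g x (J x v) (J x w) = g x v w

variable {I V} in
/-- `(J, g)` is a Hermitian structure: it is almost Hermitian and the Nijenhuis tensor of `J`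
vanishes. -/
def IsHermitian (A : AlgebroidData I V) (J : Π x, V x →L[ℝ] V x)
    (g : Π x, V x →L[ℝ] V x →L[ℝ] ℝ) : Prop :=
  IsAlmostHermitian I F J g ∧
    ∀ s t, IsSmoothSection I F s → IsSmoothSection I F t → ∀ x, A.nijenhuis J s t x = 0

end SingleBundle

section Product

variable {EM₁ : Type*} [NormedAddCommGroup EM₁] [NormedSpace ℝ EM₁]
  {H₁ : Type*} [TopologicalSpace H₁] (I₁ : ModelWithCorners ℝ EM₁ H₁)
  {M₁ : Type*} [TopologicalSpace M₁] [ChartedSpace H₁ M₁]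
  (F₁ : Type*) [NormedAddCommGroup F₁] [NormedSpace ℝ F₁]
  (V₁ : M₁ → Type*) [TopologicalSpace (Bundle.TotalSpace F₁ V₁)]
  [∀ x, TopologicalSpace (V₁ x)] [∀ x, AddCommGroup (V₁ x)] [∀ x, Module ℝ (V₁ x)]
  [FiberBundle F₁ V₁] [VectorBundle ℝ F₁ V₁]
  {EM₂ : Type*} [NormedAddCommGroup EM₂] [NormedSpace ℝ EM₂]
  {H₂ : Type*} [TopologicalSpace H₂] (I₂ : ModelWithCorners ℝ EM₂ H₂)
  {M₂ : Type*} [TopologicalSpace M₂] [ChartedSpace H₂ M₂]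
  (F₂ : Type*) [NormedAddCommGroup F₂] [NormedSpace ℝ F₂]
  (V₂ : M₂ → Type*) [TopologicalSpace (Bundle.TotalSpace F₂ V₂)]
  [∀ x, TopologicalSpace (V₂ x)] [∀ x, AddCommGroup (V₂ x)] [∀ x, Module ℝ (V₂ x)]
  [FiberBundle F₂ V₂] [VectorBundle ℝ F₂ V₂]

/-- The vector bundle `V₁ × V₂ → M₁ × M₂`, whose fibre at `(x, y)` is `V₁ x × V₂ y`. Its topology,
local trivializations and smooth structure are those of `pr₁* V₁ ⊕ pr₂* V₂`. -/
abbrev ProdBundle {M₁ M₂ : Type*} (V₁ : M₁ → Type*) (V₂ : M₂ → Type*) : M₁ × M₂ → Type _ :=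
  fun p ↦ V₁ p.1 × V₂ p.2

instance ProdBundle.topologicalSpaceTotalSpace :
    TopologicalSpace (Bundle.TotalSpace (F₁ × F₂) (ProdBundle V₁ V₂)) :=
  inferInstanceAs (TopologicalSpace (Bundle.TotalSpace (F₁ × F₂)
    ((⇑(ContinuousMap.fst : C(M₁ × M₂, M₁)) *ᵖ V₁) ×ᵇ
      (⇑(ContinuousMap.snd : C(M₁ × M₂, M₂)) *ᵖ V₂))))

instance ProdBundle.fiberBundle : FiberBundle (F₁ × F₂) (ProdBundle V₁ V₂) :=
  inferInstanceAs (FiberBundle (F₁ × F₂)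
    ((⇑(ContinuousMap.fst : C(M₁ × M₂, M₁)) *ᵖ V₁) ×ᵇ
      (⇑(ContinuousMap.snd : C(M₁ × M₂, M₂)) *ᵖ V₂)))

instance ProdBundle.vectorBundle : VectorBundle ℝ (F₁ × F₂) (ProdBundle V₁ V₂) :=
  inferInstanceAs (VectorBundle ℝ (F₁ × F₂)
    ((⇑(ContinuousMap.fst : C(M₁ × M₂, M₁)) *ᵖ V₁) ×ᵇ
      (⇑(ContinuousMap.snd : C(M₁ × M₂, M₂)) *ᵖ V₂)))

instance ProdBundle.contMDiffVectorBundle [IsManifold I₁ ∞ M₁] [IsManifold I₂ ∞ M₂]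
    [ContMDiffVectorBundle ∞ F₁ V₁ I₁] [ContMDiffVectorBundle ∞ F₂ V₂ I₂] :
    ContMDiffVectorBundle ∞ (F₁ × F₂) (ProdBundle V₁ V₂) (I₁.prod I₂) :=
  inferInstanceAs (ContMDiffVectorBundle ∞ (F₁ × F₂)
    ((⇑(ContMDiffMap.fst : ContMDiffMap (I₁.prod I₂) I₁ (M₁ × M₂) M₁ ∞) *ᵖ V₁) ×ᵇ
      (⇑(ContMDiffMap.snd : ContMDiffMap (I₁.prod I₂) I₂ (M₁ × M₂) M₂ ∞) *ᵖ V₂)) (I₁.prod I₂))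
variable {V₁} in
/-- The derivative at `y` of a map `u` from the manifold `M₂` to the fixed fibre `V₁ x`, computed
through a linear identification of `V₁ x` with the model fibre (it does not depend on which). -/
def fiberDeriv (x : M₁) (u : M₂ → V₁ x) (y : M₂) (w : TangentSpace I₂ y) : V₁ x :=
  (VectorBundle.continuousLinearEquivAt ℝ F₁ V₁ x).symm
    (mfderiv I₂ 𝓘(ℝ, F₁)
      (fun y' ↦ VectorBundle.continuousLinearEquivAt ℝ F₁ V₁ x (u y')) y w : F₁)

variable {I₁ V₁ I₂ V₂} in
/-- The direct product of two Lie algebroids. The anchor is `ρ₁ × ρ₂`. The first component of the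
bracket of `s = (s₁, s₂)` and `t = (t₁, t₂)` at `(x, y)` is the bracket in `V₁` of the sections
`s₁(·, y)` and `t₁(·, y)` at `x`, plus the derivative of `t₁(x, ·)` along `ρ₂(s₂(x, y))`, minus the
derivative of `s₁(x, ·)` along `ρ₂(t₂(x, y))`; similarly for the second component. This is the bracket
that satisfies the Leibniz rule and restricts on pulled-back sections `s₁ ⊕ s₂`, `t₁ ⊕ t₂` to
`[s₁, t₁] ⊕ [s₂, t₂]`. -/
def AlgebroidData.prod (A₁ : AlgebroidData I₁ V₁) (A₂ : AlgebroidData I₂ V₂) :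
    AlgebroidData (I₁.prod I₂) (ProdBundle V₁ V₂) where
  anchor p := (A₁.anchor p.1).prodMap (A₂.anchor p.2)
  bracket s t p :=
    (A₁.bracket (fun x ↦ (s (x, p.2)).1) (fun x ↦ (t (x, p.2)).1) p.1
        + fiberDeriv F₁ I₂ p.1 (fun y ↦ (t (p.1, y)).1) p.2 (A₂.anchor p.2 (s p).2)
        - fiberDeriv F₁ I₂ p.1 (fun y ↦ (s (p.1, y)).1) p.2 (A₂.anchor p.2 (t p).2),
      A₂.bracket (fun y ↦ (s (p.1, y)).2) (fun y ↦ (t (p.1, y)).2) p.2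
        + fiberDeriv F₂ I₁ p.2 (fun x ↦ (t (x, p.2)).2) p.1 (A₁.anchor p.1 (s p).1)
        - fiberDeriv F₂ I₁ p.2 (fun x ↦ (s (x, p.2)).2) p.1 (A₁.anchor p.1 (t p).1))

variable [∀ x, IsTopologicalAddGroup (V₁ x)] [∀ x, ContinuousSMul ℝ (V₁ x)]
  [∀ x, IsTopologicalAddGroup (V₂ x)] [∀ x, ContinuousSMul ℝ (V₂ x)]

variable {I₁ F₁ V₁ I₂ F₂ V₂} in
/-- The endomorphism `(v, w) ↦ (F₁ v - η₂(w) ξ₁, F₂ w + η₁(v) ξ₂)` of the product bundle. -/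
def AlmostContactRiemannianStructure.prodEndo
    (S₁ : AlmostContactRiemannianStructure I₁ F₁ V₁)
    (S₂ : AlmostContactRiemannianStructure I₂ F₂ V₂) (p : M₁ × M₂) :
    ProdBundle V₁ V₂ p →L[ℝ] ProdBundle V₁ V₂ p :=
  ((S₁.endo p.1 ∘L ContinuousLinearMap.fst ℝ (V₁ p.1) (V₂ p.2)
      - (S₂.form p.2 ∘L ContinuousLinearMap.snd ℝ (V₁ p.1) (V₂ p.2)).smulRight (S₁.reeb p.1)).prod
    (S₂.endo p.2 ∘L ContinuousLinearMap.snd ℝ (V₁ p.1) (V₂ p.2)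
      + (S₁.form p.1 ∘L ContinuousLinearMap.fst ℝ (V₁ p.1) (V₂ p.2)).smulRight (S₂.reeb p.2)) :
    V₁ p.1 × V₂ p.2 →L[ℝ] V₁ p.1 × V₂ p.2)

variable {I₁ F₁ V₁ I₂ F₂ V₂} in
/-- The product metric `g((v, w), (v', w')) = g₁(v, v') + g₂(w, w')` on the product bundle. -/
def AlmostContactRiemannianStructure.prodMetric
    (S₁ : AlmostContactRiemannianStructure I₁ F₁ V₁)
    (S₂ : AlmostContactRiemannianStructure I₂ F₂ V₂) (p : M₁ × M₂) :
    ProdBundle V₁ V₂ p →L[ℝ] ProdBundle V₁ V₂ p →L[ℝ] ℝ :=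
  ((ContinuousLinearMap.fst ℝ (V₁ p.1) (V₂ p.2)).precomp ℝ ∘L S₁.metric.inner p.1 ∘L
      ContinuousLinearMap.fst ℝ (V₁ p.1) (V₂ p.2)
    + (ContinuousLinearMap.snd ℝ (V₁ p.1) (V₂ p.2)).precomp ℝ ∘L S₂.metric.inner p.2 ∘L
      ContinuousLinearMap.snd ℝ (V₁ p.1) (V₂ p.2) :
    V₁ p.1 × V₂ p.2 →L[ℝ] V₁ p.1 × V₂ p.2 →L[ℝ] ℝ)

end Product

end

/-! Write J for the product endomorphism and attach to each factor four tensors: the normality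
tensor N_F + 2 dη ⊗ ξ (`normality`), [Fs, ξ] - F[s, ξ] (`lieEndo`), ρ(ξ)(η(s)) - η([ξ, s])
(`lieForm`) and 2dη(Fs, t) + 2dη(s, Ft) (`twistForm`). These are the analogues of the classical
tensors N⁽¹⁾, N⁽³⁾, N⁽⁴⁾ and N⁽²⁾ of contact geometry, up to sign.

The core is `nijenhuis_fst_formula`: the first component of N_J is the normality tensor of the first
factor, plus `lieEndo` terms of the first factor weighted by η₂, minus a multiple of ξ₁ built from
`twistForm` and `lieForm` of the second factor. All derivatives of a section along the other factor
cancel. Exchanging the factors changes only the sign of the mixed terms of J, so one computation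
with a sign ε = ±1 gives both components.

If N_J = 0, evaluating on s ⊕ 0 and 0 ⊕ s leaves only the normality tensors. Conversely, as in the
classical case, normality forces the other three tensors to vanish: put t = ξ in the normality
tensor and apply η or F, or put Fs for s and apply η. The almost Hermitian part is fibrewise algebra
from Fξ = 0 and η ∘ F = 0, together with smoothness checks. -/

noncomputable section

/-! ### Smoothness of sections along a map and of families of linear maps -/

section AlongMaps

variable {EM : Type*} [NormedAddCommGroup EM] [NormedSpace ℝ EM]
  {H : Type*} [TopologicalSpace H] {I : ModelWithCorners ℝ EM H}
  {M : Type*} [TopologicalSpace M] [ChartedSpace H M]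
  {F : Type*} [NormedAddCommGroup F] [NormedSpace ℝ F]
  {V : M → Type*} [TopologicalSpace (Bundle.TotalSpace F V)]
  [∀ x, TopologicalSpace (V x)] [∀ x, AddCommGroup (V x)] [∀ x, Module ℝ (V x)]
  [FiberBundle F V] [VectorBundle ℝ F V]
  {EN : Type*} [NormedAddCommGroup EN] [NormedSpace ℝ EN]
  {HN : Type*} [TopologicalSpace HN] {IN : ModelWithCorners ℝ EN HN}
  {N : Type*} [TopologicalSpace N] [ChartedSpace HN N]
  {b : N → M} {v w : Π n, V (b n)} {n : N} {k : WithTop ℕ∞}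

/-- The components of a section of the product bundle depend on both variables, so they are sections
along the projections and not sections of the factors. Near n the map b stays in one base set, where
the trivialization is linear on fibres. -/
theorem ContMDiffAt.add_along
    (hv : ContMDiffAt IN (I.prod 𝓘(ℝ, F)) k (fun m ↦ Bundle.TotalSpace.mk' F (b m) (v m)) n)
    (hw : ContMDiffAt IN (I.prod 𝓘(ℝ, F)) k (fun m ↦ Bundle.TotalSpace.mk' F (b m) (w m)) n) :
    ContMDiffAt IN (I.prod 𝓘(ℝ, F)) k
      (fun m ↦ Bundle.TotalSpace.mk' F (b m) (v m + w m)) n := by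
  rw [Bundle.contMDiffAt_totalSpace] at hv hw ⊢
  refine ⟨hv.1, (hv.2.add hw.2).congr_of_eventuallyEq ?_⟩
  have h : ∀ᶠ m in 𝓝 n, b m ∈ (trivializationAt F V (b n)).baseSet :=
    hv.1.continuousAt ((trivializationAt F V (b n)).open_baseSet.mem_nhds
      (FiberBundle.mem_baseSet_trivializationAt' (b n)))
  filter_upwards [h] with m hm
  exact ((trivializationAt F V (b n)).linear ℝ hm).1 (v m) (w m)

theorem ContMDiffAt.smul_along {f : N → ℝ} (hf : ContMDiffAt IN 𝓘(ℝ, ℝ) k f n)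
    (hv : ContMDiffAt IN (I.prod 𝓘(ℝ, F)) k (fun m ↦ Bundle.TotalSpace.mk' F (b m) (v m)) n) :
    ContMDiffAt IN (I.prod 𝓘(ℝ, F)) k
      (fun m ↦ Bundle.TotalSpace.mk' F (b m) (f m • v m)) n := by
  rw [Bundle.contMDiffAt_totalSpace] at hv ⊢
  refine ⟨hv.1, (hf.smul hv.2).congr_of_eventuallyEq ?_⟩
  have h : ∀ᶠ m in 𝓝 n, b m ∈ (trivializationAt F V (b n)).baseSet :=
    hv.1.continuousAt ((trivializationAt F V (b n)).open_baseSet.mem_nhds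
      (FiberBundle.mem_baseSet_trivializationAt' (b n)))
  filter_upwards [h] with m hm
  exact ((trivializationAt F V (b n)).linear ℝ hm).2 (f m) (v m)

theorem ContMDiffAt.neg_along
    (hv : ContMDiffAt IN (I.prod 𝓘(ℝ, F)) k (fun m ↦ Bundle.TotalSpace.mk' F (b m) (v m)) n) :
    ContMDiffAt IN (I.prod 𝓘(ℝ, F)) k
      (fun m ↦ Bundle.TotalSpace.mk' F (b m) (-v m)) n := by
  simpa using (contMDiffAt_const (c := (-1 : ℝ))).smul_along hv

theorem ContMDiffAt.sub_along
    (hv : ContMDiffAt IN (I.prod 𝓘(ℝ, F)) k (fun m ↦ Bundle.TotalSpace.mk' F (b m) (v m)) n)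
    (hw : ContMDiffAt IN (I.prod 𝓘(ℝ, F)) k (fun m ↦ Bundle.TotalSpace.mk' F (b m) (w m)) n) :
    ContMDiffAt IN (I.prod 𝓘(ℝ, F)) k
      (fun m ↦ Bundle.TotalSpace.mk' F (b m) (v m - w m)) n := by
  simpa [sub_eq_add_neg] using hv.add_along hw.neg_along

/-- A basis of F identifies F →L F' with a finite power of F', and evaluations at the basis vectors
become the coordinates. -/
theorem contMDiffAt_clm_of_apply [FiniteDimensional ℝ F]
    {F' : Type*} [NormedAddCommGroup F'] [NormedSpace ℝ F'] {φ : N → F →L[ℝ] F'}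
    (h : ∀ c, ContMDiffAt IN 𝓘(ℝ, F') k (fun m ↦ φ m c) n) :
    ContMDiffAt IN 𝓘(ℝ, F →L[ℝ] F') k φ n := by
  let d := Module.finrank ℝ F
  have hd : d = Module.finrank ℝ (Fin d → ℝ) := (Module.finrank_fin_fun ℝ).symm
  let e₁ := ContinuousLinearEquiv.ofFinrankEq hd
  let e₂ := (e₁.arrowCongr (1 : F' ≃L[ℝ] F')).trans (ContinuousLinearEquiv.piRing (Fin d))
  have : φ = e₂.symm ∘ (e₂ ∘ φ) := by
    rw [← Function.comp_assoc, e₂.symm_comp_self, Function.id_comp]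
  rw [this]
  exact e₂.symm.contDiff.contMDiff.contMDiffAt.comp n
    (contMDiffAt_pi_space.mpr fun i ↦ h _)

/-- A family of linear maps between the fibres of two bundles is smooth at a point if it maps local
sections that are smooth at this point to sections that are smooth at this point. -/
theorem contMDiffAt_hom_of_apply [FiniteDimensional ℝ F]
    [∀ x, IsTopologicalAddGroup (V x)] [∀ x, ContinuousSMul ℝ (V x)]
    [ContMDiffVectorBundle k F V I]
    {F' : Type*} [NormedAddCommGroup F'] [NormedSpace ℝ F']
    {V' : M → Type*} [TopologicalSpace (Bundle.TotalSpace F' V')]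
    [∀ x, TopologicalSpace (V' x)] [∀ x, AddCommGroup (V' x)] [∀ x, Module ℝ (V' x)]
    [FiberBundle F' V'] [VectorBundle ℝ F' V']
    [∀ x, IsTopologicalAddGroup (V' x)] [∀ x, ContinuousSMul ℝ (V' x)]
    {φ : Π x, V x →L[ℝ] V' x} {x : M}
    (h : ∀ s : Π x, V x,
      ContMDiffAt I (I.prod 𝓘(ℝ, F)) k (fun y ↦ Bundle.TotalSpace.mk' F y (s y)) x →
      ContMDiffAt I (I.prod 𝓘(ℝ, F')) k (fun y ↦ Bundle.TotalSpace.mk' F' y (φ y (s y))) x) :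
    ContMDiffAt I (I.prod 𝓘(ℝ, F →L[ℝ] F')) k
      (fun y ↦ Bundle.TotalSpace.mk' (F →L[ℝ] F') (E := fun y ↦ V y →L[ℝ] V' y) y (φ y)) x := by
  rw [contMDiffAt_hom_bundle]
  refine ⟨contMDiffAt_id, contMDiffAt_clm_of_apply fun c ↦ ?_⟩
  have hx := FiberBundle.mem_baseSet_trivializationAt' (F := F) (E := V) x
  have hx' := FiberBundle.mem_baseSet_trivializationAt' (F := F') (E := V') x
  -- The test section is the one with constant coordinate c in the trivialization at x. It need only
  -- be smooth near x, so no cutoff function is required.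
  have hs := (Bundle.contMDiffAt_totalSpace.1
    (h (fun y ↦ (trivializationAt F V x).symmL ℝ y c) ?_)).2
  · refine hs.congr_of_eventuallyEq ?_
    filter_upwards [(trivializationAt F V x).open_baseSet.mem_nhds hx,
      (trivializationAt F' V' x).open_baseSet.mem_nhds hx'] with y hy hy'
    simp [ContinuousLinearMap.inCoordinates, Bundle.Trivialization.coe_linearMapAt_of_mem _ hy']
  · rw [Bundle.contMDiffAt_section]
    refine (contMDiffAt_const (c := c)).congr_of_eventuallyEq ?_
    filter_upwards [(trivializationAt F V x).open_baseSet.mem_nhds hx] with y hy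
    simp [(trivializationAt F V x).symmL_apply hy, (trivializationAt F V x).apply_mk_symm hy]

end AlongMaps

/-! ### Sections of the product bundle and their slices -/

section ProdBundle

variable {EM₁ : Type*} [NormedAddCommGroup EM₁] [NormedSpace ℝ EM₁]
  {H₁ : Type*} [TopologicalSpace H₁] {I₁ : ModelWithCorners ℝ EM₁ H₁}
  {M₁ : Type*} [TopologicalSpace M₁] [ChartedSpace H₁ M₁]
  {F₁ : Type*} [NormedAddCommGroup F₁] [NormedSpace ℝ F₁]
  {V₁ : M₁ → Type*} [TopologicalSpace (Bundle.TotalSpace F₁ V₁)]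
  [∀ x, TopologicalSpace (V₁ x)] [∀ x, AddCommGroup (V₁ x)]
  [FiberBundle F₁ V₁]
  {EM₂ : Type*} [NormedAddCommGroup EM₂] [NormedSpace ℝ EM₂]
  {H₂ : Type*} [TopologicalSpace H₂] {I₂ : ModelWithCorners ℝ EM₂ H₂}
  {M₂ : Type*} [TopologicalSpace M₂] [ChartedSpace H₂ M₂]
  {F₂ : Type*} [NormedAddCommGroup F₂] [NormedSpace ℝ F₂]
  {V₂ : M₂ → Type*} [TopologicalSpace (Bundle.TotalSpace F₂ V₂)]
  [∀ x, TopologicalSpace (V₂ x)] [∀ x, AddCommGroup (V₂ x)]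
  [FiberBundle F₂ V₂]
  {EN : Type*} [NormedAddCommGroup EN] [NormedSpace ℝ EN]
  {HN : Type*} [TopologicalSpace HN] {IN : ModelWithCorners ℝ EN HN}
  {N : Type*} [TopologicalSpace N] [ChartedSpace HN N]

/-- A map into the total space of the product bundle is smooth if and only if its two components
are. -/
theorem ProdBundle.contMDiffAt_iff {k : WithTop ℕ∞} {b : N → M₁ × M₂}
    {v : Π m, ProdBundle V₁ V₂ (b m)} {n : N} :
    ContMDiffAt IN ((I₁.prod I₂).prod 𝓘(ℝ, F₁ × F₂)) k
        (fun m ↦ Bundle.TotalSpace.mk' (F₁ × F₂) (E := ProdBundle V₁ V₂) (b m) (v m)) n ↔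
      ContMDiffAt IN (I₁.prod 𝓘(ℝ, F₁)) k
          (fun m ↦ Bundle.TotalSpace.mk' F₁ (b m).1 (v m).1) n ∧
        ContMDiffAt IN (I₂.prod 𝓘(ℝ, F₂)) k
          (fun m ↦ Bundle.TotalSpace.mk' F₂ (b m).2 (v m).2) n := by
  simp only [Bundle.contMDiffAt_totalSpace]
  rw [contMDiffAt_prod_iff, modelWithCornersSelf_prod, ← chartedSpaceSelf_prod,
    contMDiffAt_prod_iff, and_and_and_comm]
  -- The preferred trivializations of the product bundle are by definition products of those of the
  -- factors.
  rfl

variable {s : Π p : M₁ × M₂, ProdBundle V₁ V₂ p} {b : N → M₁ × M₂}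

namespace IsSmoothSection

theorem fst_along (hs : IsSmoothSection (I₁.prod I₂) (F₁ × F₂) s)
    (hb : ContMDiff IN (I₁.prod I₂) ∞ b) :
    ContMDiff IN (I₁.prod 𝓘(ℝ, F₁)) ∞
      (fun n ↦ Bundle.TotalSpace.mk' F₁ (b n).1 (s (b n)).1) := fun n ↦ by
  have h : ContMDiffAt IN ((I₁.prod I₂).prod 𝓘(ℝ, F₁ × F₂)) ∞
      (fun n ↦ Bundle.TotalSpace.mk' (F₁ × F₂) (E := ProdBundle V₁ V₂) (b n) (s (b n))) n :=
    ContMDiffAt.comp n (hs (b n)) (hb n)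
  exact (ProdBundle.contMDiffAt_iff.1 h).1

theorem snd_along (hs : IsSmoothSection (I₁.prod I₂) (F₁ × F₂) s)
    (hb : ContMDiff IN (I₁.prod I₂) ∞ b) :
    ContMDiff IN (I₂.prod 𝓘(ℝ, F₂)) ∞
      (fun n ↦ Bundle.TotalSpace.mk' F₂ (b n).2 (s (b n)).2) := fun n ↦ by
  have h : ContMDiffAt IN ((I₁.prod I₂).prod 𝓘(ℝ, F₁ × F₂)) ∞
      (fun n ↦ Bundle.TotalSpace.mk' (F₁ × F₂) (E := ProdBundle V₁ V₂) (b n) (s (b n))) n :=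
    ContMDiffAt.comp n (hs (b n)) (hb n)
  exact (ProdBundle.contMDiffAt_iff.1 h).2

/-- The pullback `s₁ ⊕ s₂` of two sections to the product. -/
theorem prod {s₁ : Π x, V₁ x} {s₂ : Π y, V₂ y} (h₁ : IsSmoothSection I₁ F₁ s₁)
    (h₂ : IsSmoothSection I₂ F₂ s₂) :
    IsSmoothSection (I₁.prod I₂) (F₁ × F₂) (V := ProdBundle V₁ V₂)
      (fun p ↦ (s₁ p.1, s₂ p.2)) := fun p ↦
  ProdBundle.contMDiffAt_iff.2
    ⟨ContMDiffAt.comp p (h₁ p.1) contMDiffAt_fst, ContMDiffAt.comp p (h₂ p.2) contMDiffAt_snd⟩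

theorem slice_fst (hs : IsSmoothSection (I₁.prod I₂) (F₁ × F₂) s) (y : M₂) :
    IsSmoothSection I₁ F₁ (fun x ↦ (s (x, y)).1) :=
  hs.fst_along (b := fun x ↦ (x, y)) (contMDiff_id.prodMk contMDiff_const)

theorem slice_snd (hs : IsSmoothSection (I₁.prod I₂) (F₁ × F₂) s) (x : M₁) :
    IsSmoothSection I₂ F₂ (fun y ↦ (s (x, y)).2) :=
  hs.snd_along (b := fun y ↦ (x, y)) (contMDiff_const.prodMk contMDiff_id)

end IsSmoothSection

end ProdBundle

/-! ### Bracket calculus on one Lie algebroid -/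

section SingleBundle

variable {EM : Type*} [NormedAddCommGroup EM] [NormedSpace ℝ EM]
  {H : Type*} [TopologicalSpace H] {I : ModelWithCorners ℝ EM H}
  {M : Type*} [TopologicalSpace M] [ChartedSpace H M]
  {F : Type*} [NormedAddCommGroup F] [NormedSpace ℝ F]
  {V : M → Type*} [TopologicalSpace (Bundle.TotalSpace F V)]
  [∀ x, TopologicalSpace (V x)] [∀ x, AddCommGroup (V x)] [∀ x, Module ℝ (V x)]
  [FiberBundle F V] [VectorBundle ℝ F V]

namespace IsSmoothSection

variable {s t : Π x, V x}

theorem zero : IsSmoothSection I F (fun x ↦ (0 : V x)) :=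
  Bundle.contMDiff_zeroSection ℝ V

theorem neg (hs : IsSmoothSection I F s) : IsSmoothSection I F (fun x ↦ -s x) :=
  fun x ↦ (hs x).neg_along

theorem sub (hs : IsSmoothSection I F s) (ht : IsSmoothSection I F t) :
    IsSmoothSection I F (fun x ↦ s x - t x) :=
  fun x ↦ (hs x).sub_along (ht x)

theorem smul {f : M → ℝ} (hf : ContMDiff I 𝓘(ℝ, ℝ) ∞ f) (hs : IsSmoothSection I F s) :
    IsSmoothSection I F (fun x ↦ f x • s x) :=
  fun x ↦ (hf x).smul_along (hs x)

theorem form {η : Π x, V x →L[ℝ] ℝ} (hη : IsSmoothOneForm I F η)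
    (hs : IsSmoothSection I F s) : ContMDiff I 𝓘(ℝ, ℝ) ∞ (fun x ↦ η x (s x)) := fun x ↦
  (Bundle.contMDiffAt_totalSpace.1
    (ContMDiffAt.clm_bundle_apply (F₂ := ℝ) (E₂ := Bundle.Trivial M ℝ) (b := id) (hη x) (hs x))).2

variable [∀ x, IsTopologicalAddGroup (V x)] [∀ x, ContinuousSMul ℝ (V x)]

theorem endo {J : Π x, V x →L[ℝ] V x} (hJ : IsSmoothEndo I F J) (hs : IsSmoothSection I F s) :
    IsSmoothSection I F (fun x ↦ J x (s x)) :=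
  ContMDiff.clm_bundle_apply hJ hs

end IsSmoothSection

theorem AlgebroidData.anchorDeriv_sub_smul (A : AlgebroidData I V) (s t : Π x, V x)
    (g f : M → ℝ) (x : M) :
    A.anchorDeriv (fun y ↦ s y - g y • t y) f x
      = A.anchorDeriv s f x - g x * A.anchorDeriv t f x := by
  simp only [AlgebroidData.anchorDeriv, map_sub, map_smul]
  rfl

theorem AlgebroidData.anchorDeriv_const_mul (A : AlgebroidData I V) (s : Π x, V x)
    (c : ℝ) {f : M → ℝ} {x : M} (hf : MDifferentiableAt I 𝓘(ℝ, ℝ) f x) :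
    A.anchorDeriv s (fun y ↦ c * f y) x = c * A.anchorDeriv s f x := by
  have := const_smul_mfderiv hf c
  unfold AlgebroidData.anchorDeriv
  change mfderiv I 𝓘(ℝ, ℝ) (c • f) x _ = _
  rw [this]
  rfl

theorem AlgebroidData.anchorDeriv_const (A : AlgebroidData I V) (s : Π x, V x) (c : ℝ) (x : M) :
    A.anchorDeriv s (fun _ ↦ c) x = 0 := by
  simp only [AlgebroidData.anchorDeriv, mfderiv_const]
  rfl

namespace LieAlgebroid

variable [IsManifold I ∞ M]
  (A : LieAlgebroid I F V) {s t u : Π x, V x} {f : M → ℝ}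

theorem bracket_skew_apply (hs : IsSmoothSection I F s) (ht : IsSmoothSection I F t) (x : M) :
    A.bracket s t x = -A.bracket t s x :=
  congrFun (A.bracket_skew s t hs ht) x

theorem bracket_self (hs : IsSmoothSection I F s) (x : M) : A.bracket s s x = 0 := by
  have h := A.bracket_skew_apply hs hs x
  have h2 : (2 : ℝ) • A.bracket s s x = 0 := by
    rw [two_smul]
    nth_rewrite 1 [h]
    simp
  simpa using h2

theorem bracket_neg_left (hs : IsSmoothSection I F s) (ht : IsSmoothSection I F t) (x : M) :
    A.bracket (fun y ↦ -s y) t x = -A.bracket s t x := by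
  have h := congrFun (A.bracket_const_smul (-1) t s ht hs) x
  have e : ((-1 : ℝ) • s : Π x, V x) = fun y ↦ -s y := by
    ext y
    simp
  rw [e] at h
  rw [A.bracket_skew_apply hs.neg ht, h, A.bracket_skew_apply hs ht]
  simp

theorem bracket_zero_right (hs : IsSmoothSection I F s) (x : M) :
    A.bracket s (fun _ ↦ 0) x = 0 := by
  have h := congrFun (A.bracket_const_smul 0 s s hs hs) x
  have e : ((0 : ℝ) • s : Π x, V x) = fun y ↦ 0 := by
    ext y
    simp
  rw [e] at h
  simpa using h

theorem bracket_zero_left (hs : IsSmoothSection I F s) (x : M) :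
    A.bracket (fun _ ↦ 0) s x = 0 := by
  rw [A.bracket_skew_apply .zero hs, A.bracket_zero_right hs, neg_zero]

/-- The Leibniz rule for a difference, in the second argument. -/
theorem bracket_sub_smul_right (hs : IsSmoothSection I F s) (ht : IsSmoothSection I F t)
    (hu : IsSmoothSection I F u) (hf : ContMDiff I 𝓘(ℝ, ℝ) ∞ f) (x : M) :
    A.bracket s (fun y ↦ t y - f y • u y) x
      = A.bracket s t x - f x • A.bracket s u x - A.anchorDeriv s f x • u x := by
  have hfu := IsSmoothSection.smul hf hu
  have h := congrFun (A.bracket_add s t ((-1 : ℝ) • fun y ↦ f y • u y) hs ht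
    (by rw [neg_one_smul]; exact hfu.neg)) x
  have h' := congrFun (A.bracket_const_smul (-1) s _ hs hfu) x
  have e : (t + (-1 : ℝ) • fun y ↦ f y • u y : Π x, V x) = fun y ↦ t y - f y • u y := by
    ext y
    simp [sub_eq_add_neg]
  rw [e] at h
  rw [h, Pi.add_apply, h', Pi.smul_apply, A.leibniz s u f hs hu hf]
  module

/-- The Leibniz rule for a difference, in the first argument. -/
theorem bracket_sub_smul_left (hs : IsSmoothSection I F s) (ht : IsSmoothSection I F t)
    (hu : IsSmoothSection I F u) (hf : ContMDiff I 𝓘(ℝ, ℝ) ∞ f) (x : M) :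
    A.bracket (fun y ↦ s y - f y • u y) t x
      = A.bracket s t x - f x • A.bracket u t x + A.anchorDeriv t f x • u x := by
  rw [A.bracket_skew_apply (hs.sub (.smul hf hu)) ht, A.bracket_sub_smul_right ht hs hu hf,
    A.bracket_skew_apply hs ht, A.bracket_skew_apply hu ht]
  module

end LieAlgebroid

/-! ### Structure tensors of an almost contact structure and consequences of normality -/

namespace AlmostContactRiemannianStructure

variable [∀ x, IsTopologicalAddGroup (V x)] [∀ x, ContinuousSMul ℝ (V x)]
  (S : AlmostContactRiemannianStructure I F V)

theorem reeb_ne_zero (x : M) : S.reeb x ≠ 0 := fun h ↦ by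
  simpa [h] using S.form_reeb x

/-- F²ξ = -ξ + ξ = 0, so F²(Fξ) = 0 as well, which reads Fξ = η(Fξ) ξ. Applying F gives η(Fξ) Fξ =
0, and either factor being zero yields the claim. -/
theorem endo_reeb (x : M) : S.endo x (S.reeb x) = 0 := by
  have h2 : S.endo x (S.endo x (S.reeb x)) = 0 := by
    rw [S.endo_endo, S.form_reeb]
    simp
  have h3 : S.endo x (S.reeb x) = S.form x (S.endo x (S.reeb x)) • S.reeb x := by
    have h := S.endo_endo x (S.endo x (S.reeb x))
    rw [h2, map_zero] at h
    exact (neg_add_eq_zero.1 h.symm)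
  rw [h3, map_smul] at h2
  rcases smul_eq_zero.1 h2 with h | h
  · rw [h3, h, zero_smul]
  · exact h

/-- Compute F³v as F(F²v) and as F²(Fv): the difference is η(Fv) ξ, and ξ does not vanish. -/
theorem form_endo (x : M) (v : V x) : S.form x (S.endo x v) = 0 := by
  have h := congrArg (S.endo x) (S.endo_endo x v)
  rw [map_add, map_smul, S.endo_reeb, map_neg, S.endo_endo] at h
  have h' : S.form x (S.endo x v) • S.reeb x = 0 := by simpa using h
  exact (smul_eq_zero.1 h').resolve_right (S.reeb_ne_zero x)

theorem inner_self_nonneg (x : M) (v : V x) : 0 ≤ S.metric.inner x v v := by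
  rcases eq_or_ne v 0 with rfl | h
  · simp
  · exact (S.metric.pos x v h).le

theorem metric_reeb_reeb (x : M) : S.metric.inner x (S.reeb x) (S.reeb x) = 1 := by
  have h := S.metric_endo x (S.reeb x) (S.reeb x)
  simp only [S.endo_reeb, S.form_reeb, map_zero] at h
  linarith

theorem metric_endo_reeb (x : M) (v : V x) :
    S.metric.inner x (S.endo x v) (S.reeb x) = 0 := by
  have h := S.metric_endo x (S.endo x v) (S.reeb x)
  simp only [S.endo_reeb, S.form_endo, map_zero] at h
  linarith

theorem metric_reeb_endo (x : M) (v : V x) :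
    S.metric.inner x (S.reeb x) (S.endo x v) = 0 := by
  rw [S.metric.symm, S.metric_endo_reeb]

/-- The normality tensor `N_F + 2 dη ⊗ ξ`. -/
def normality (A : AlgebroidData I V) (s t : Π x, V x) (x : M) : V x :=
  A.nijenhuis S.endo s t x + (2 * A.extDeriv S.form s t x) • S.reeb x

/-- The derivative of the endomorphism along the Reeb section: `[F s, ξ] - F [s, ξ]`. -/
def lieEndo (A : AlgebroidData I V) (s : Π x, V x) (x : M) : V x :=
  A.bracket (fun y ↦ S.endo y (s y)) S.reeb x - S.endo x (A.bracket s S.reeb x)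

/-- The derivative of the one-form along the Reeb section: `ρ(ξ)(η(s)) - η([ξ, s])`. -/
def lieForm (A : AlgebroidData I V) (s : Π x, V x) (x : M) : ℝ :=
  A.anchorDeriv S.reeb (fun y ↦ S.form y (s y)) x - S.form x (A.bracket S.reeb s x)

/-- The tensor `2 dη(F s, t) + 2 dη(s, F t)`, written out with `η ∘ F = 0`. -/
def twistForm (A : AlgebroidData I V) (s t : Π x, V x) (x : M) : ℝ :=
  A.anchorDeriv (fun y ↦ S.endo y (s y)) (fun y ↦ S.form y (t y)) x
    - A.anchorDeriv (fun y ↦ S.endo y (t y)) (fun y ↦ S.form y (s y)) x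
    - S.form x (A.bracket (fun y ↦ S.endo y (s y)) t x)
    - S.form x (A.bracket s (fun y ↦ S.endo y (t y)) x)

theorem normality_eq (A : AlgebroidData I V) (s t : Π x, V x) (x : M) :
    S.normality A s t x
      = A.bracket (fun y ↦ S.endo y (s y)) (fun y ↦ S.endo y (t y)) x
        - S.endo x (A.bracket (fun y ↦ S.endo y (s y)) t x)
        - S.endo x (A.bracket s (fun y ↦ S.endo y (t y)) x) - A.bracket s t x
        + (A.anchorDeriv s (fun y ↦ S.form y (t y)) x
          - A.anchorDeriv t (fun y ↦ S.form y (s y)) x) • S.reeb x := by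
  simp only [normality, AlgebroidData.nijenhuis, AlgebroidData.extDeriv, S.endo_endo]
  module

theorem lieForm_zero [IsManifold I ∞ M] (A : LieAlgebroid I F V) (x : M) :
    S.lieForm A.toAlgebroidData (fun _ ↦ 0) x = 0 := by
  simp only [lieForm, A.bracket_zero_right S.smooth_reeb, map_zero,
    AlgebroidData.anchorDeriv_const, sub_zero]

theorem twistForm_zero [IsManifold I ∞ M] (A : LieAlgebroid I F V) (x : M) :
    S.twistForm A.toAlgebroidData (fun _ ↦ 0) (fun _ ↦ 0) x = 0 := by
  simp only [twistForm, map_zero, A.bracket_zero_left .zero,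
    AlgebroidData.anchorDeriv_const, sub_zero]

variable [IsManifold I ∞ M] {S} {A : LieAlgebroid I F V} {s t : Π x, V x}

/-- Apply η to the normality tensor at (s, ξ): the terms with Fξ vanish, those in the image of F are
killed by η, and η(ξ) = 1 is constant. -/
theorem IsNormal.form_bracket_reeb (h : S.IsNormal A.toAlgebroidData)
    (hs : IsSmoothSection I F s) (x : M) :
    S.form x (A.bracket s S.reeb x) = -A.anchorDeriv S.reeb (fun y ↦ S.form y (s y)) x := by
  have h1 := h s S.reeb hs S.smooth_reeb x
  change S.normality _ _ _ _ = 0 at h1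
  rw [S.normality_eq] at h1
  simp only [S.endo_reeb, S.form_reeb, A.bracket_zero_right hs,
    A.bracket_zero_right (hs.endo S.smooth_endo), AlgebroidData.anchorDeriv_const] at h1
  have h2 := congrArg (S.form x) h1
  simp only [map_add, map_sub, map_zero, map_smul, S.form_endo, S.form_reeb, smul_eq_mul] at h2
  linarith

theorem IsNormal.lieForm_eq_zero (h : S.IsNormal A.toAlgebroidData)
    (hs : IsSmoothSection I F s) (x : M) : S.lieForm A.toAlgebroidData s x = 0 := by
  have h1 := h.form_bracket_reeb hs x
  rw [A.bracket_skew_apply hs S.smooth_reeb, map_neg] at h1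
  rw [lieForm]
  linarith

/-- Apply F to the normality tensor at (s, ξ). Since -F² = 1 - η ⊗ ξ, this is the required tensor up
to η([Fs, ξ]) ξ, which vanishes by `form_bracket_reeb` at Fs because η ∘ F = 0. -/
theorem IsNormal.lieEndo_eq_zero (h : S.IsNormal A.toAlgebroidData)
    (hs : IsSmoothSection I F s) (x : M) : S.lieEndo A.toAlgebroidData s x = 0 := by
  have h1 := h s S.reeb hs S.smooth_reeb x
  change S.normality _ _ _ _ = 0 at h1
  rw [S.normality_eq] at h1
  simp only [S.endo_reeb, S.form_reeb, A.bracket_zero_right hs,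
    A.bracket_zero_right (hs.endo S.smooth_endo), AlgebroidData.anchorDeriv_const] at h1
  have h2 := congrArg (S.endo x) h1
  have h3 := h.form_bracket_reeb (hs.endo S.smooth_endo) x
  simp only [S.form_endo, AlgebroidData.anchorDeriv_const] at h3
  simp only [map_add, map_sub, map_zero, map_smul, S.endo_endo, S.endo_reeb, h3] at h2
  rw [lieEndo, ← h2]
  module

/-- Apply η to the normality tensor at (Fs, t). Expanding [F²s, Ft] with F²s = -s + η(s) ξ by the
Leibniz rule gives the required tensor plus η(s) η([ξ, Ft]), and the last term vanishes by
`form_bracket_reeb`. -/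
theorem IsNormal.twistForm_eq_zero (h : S.IsNormal A.toAlgebroidData)
    (hs : IsSmoothSection I F s) (ht : IsSmoothSection I F t) (x : M) :
    S.twistForm A.toAlgebroidData s t x = 0 := by
  have hFs := hs.endo S.smooth_endo
  have hFt := ht.endo S.smooth_endo
  have h1 := h (fun y ↦ S.endo y (s y)) t hFs ht x
  change S.normality _ _ _ _ = 0 at h1
  rw [S.normality_eq] at h1
  have e : (fun y ↦ S.endo y (S.endo y (s y)))
      = fun y ↦ -s y - (-S.form y (s y)) • S.reeb y := by
    ext y
    rw [S.endo_endo, neg_smul, sub_neg_eq_add]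
  have hη := hs.form S.smooth_form
  have h2 := congrArg (S.form x) h1
  have h3 := h.form_bracket_reeb hFt x
  rw [A.bracket_skew_apply hFt S.smooth_reeb] at h3
  have hm := AlgebroidData.anchorDeriv_const_mul A.toAlgebroidData
    (fun y ↦ S.endo y (t y)) (-1) (hη.mdifferentiableAt (x := x) (by simp))
  simp only [neg_mul, one_mul] at hm
  rw [e, A.bracket_sub_smul_left hs.neg hFt S.smooth_reeb (f := fun y ↦ -S.form y (s y)) hη.neg,
    A.bracket_neg_left hs hFt] at h2
  simp only [map_add, map_sub, map_zero, map_neg, map_smul, S.form_endo, S.form_reeb, smul_eq_mul,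
    AlgebroidData.anchorDeriv_const, hm] at h2 h3
  rw [twistForm]
  linear_combination h2 + S.form x (s x) * h3

end AlmostContactRiemannianStructure

end SingleBundle

/-! ### Derivatives in a fixed fibre and the component formula for the Nijenhuis tensor -/

section Slices

variable {EM₁ : Type*} [NormedAddCommGroup EM₁] [NormedSpace ℝ EM₁]
  {H₁ : Type*} [TopologicalSpace H₁] {I₁ : ModelWithCorners ℝ EM₁ H₁}
  {M₁ : Type*} [TopologicalSpace M₁] [ChartedSpace H₁ M₁]
  {F₁ : Type*} [NormedAddCommGroup F₁] [NormedSpace ℝ F₁]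
  {V₁ : M₁ → Type*} [TopologicalSpace (Bundle.TotalSpace F₁ V₁)]
  [∀ x, TopologicalSpace (V₁ x)] [∀ x, AddCommGroup (V₁ x)] [∀ x, Module ℝ (V₁ x)]
  [FiberBundle F₁ V₁] [VectorBundle ℝ F₁ V₁]
  {EM₂ : Type*} [NormedAddCommGroup EM₂] [NormedSpace ℝ EM₂]
  {H₂ : Type*} [TopologicalSpace H₂] {I₂ : ModelWithCorners ℝ EM₂ H₂}
  {M₂ : Type*} [TopologicalSpace M₂] [ChartedSpace H₂ M₂]
  {F₂ : Type*} [NormedAddCommGroup F₂] [NormedSpace ℝ F₂]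
  {V₂ : M₂ → Type*} [TopologicalSpace (Bundle.TotalSpace F₂ V₂)]
  [∀ x, TopologicalSpace (V₂ x)] [∀ x, AddCommGroup (V₂ x)] [∀ x, Module ℝ (V₂ x)]
  [FiberBundle F₂ V₂] [VectorBundle ℝ F₂ V₂]

variable (F₁ I₂) in
/-- The map `u` from a manifold to a fixed fibre is smooth. -/
def IsSmoothToFiber (x : M₁) (u : M₂ → V₁ x) : Prop :=
  ContMDiff I₂ 𝓘(ℝ, F₁) ∞ (fun y ↦ VectorBundle.continuousLinearEquivAt ℝ F₁ V₁ x (u y))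

namespace IsSmoothToFiber

variable {x : M₁} {u v : M₂ → V₁ x} {y : M₂}

theorem clm_apply {F : Type*} [NormedAddCommGroup F] [NormedSpace ℝ F]
    (hu : IsSmoothToFiber F₁ I₂ x u) (L : V₁ x →L[ℝ] F) :
    ContMDiff I₂ 𝓘(ℝ, F) ∞ (fun y ↦ L (u y)) := by
  have h := (L ∘L ((VectorBundle.continuousLinearEquivAt ℝ F₁ V₁ x).symm :
    F₁ →L[ℝ] V₁ x)).contDiff (n := ∞) |>.contMDiff.comp hu
  simpa only [Function.comp_def, ContinuousLinearMap.comp_apply, ContinuousLinearEquiv.coe_coe,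
    ContinuousLinearEquiv.symm_apply_apply] using h

theorem endo (hu : IsSmoothToFiber F₁ I₂ x u) (L : V₁ x →L[ℝ] V₁ x) :
    IsSmoothToFiber F₁ I₂ x (fun y ↦ L (u y)) :=
  hu.clm_apply (((VectorBundle.continuousLinearEquivAt ℝ F₁ V₁ x) : V₁ x →L[ℝ] F₁) ∘L L)

end IsSmoothToFiber

variable {x : M₁} {u v : M₂ → V₁ x} {y : M₂}

/-- The derivative of a vector-valued function in the direction of a tangent vector. -/
def dirDeriv {EM : Type*} [NormedAddCommGroup EM] [NormedSpace ℝ EM]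
    {H : Type*} [TopologicalSpace H] (I : ModelWithCorners ℝ EM H)
    {M : Type*} [TopologicalSpace M] [ChartedSpace H M]
    {F : Type*} [NormedAddCommGroup F] [NormedSpace ℝ F] (f : M → F) (x : M)
    (w : TangentSpace I x) : F :=
  mfderiv I 𝓘(ℝ, F) f x w

section DirDeriv

variable {F : Type*} [NormedAddCommGroup F] [NormedSpace ℝ F] {f g : M₂ → F}

theorem dirDeriv_sub_dir (f : M₂ → F) (w w' : TangentSpace I₂ y) :
    dirDeriv I₂ f y (w - w') = dirDeriv I₂ f y w - dirDeriv I₂ f y w' :=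
  map_sub (mfderiv I₂ 𝓘(ℝ, F) f y) w w'

theorem dirDeriv_smul_dir (f : M₂ → F) (r : ℝ) (w : TangentSpace I₂ y) :
    dirDeriv I₂ f y (r • w) = r • dirDeriv I₂ f y w :=
  map_smul (mfderiv I₂ 𝓘(ℝ, F) f y) r w

theorem dirDeriv_sub (hf : ContMDiff I₂ 𝓘(ℝ, F) ∞ f) (hg : ContMDiff I₂ 𝓘(ℝ, F) ∞ g)
    (w : TangentSpace I₂ y) :
    dirDeriv I₂ (fun y ↦ f y - g y) y w = dirDeriv I₂ f y w - dirDeriv I₂ g y w :=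
  DFunLike.congr_fun ((hf.mdifferentiableAt (x := y) (by simp)).hasMFDerivAt.sub
    (hg.mdifferentiableAt (x := y) (by simp)).hasMFDerivAt).mfderiv w

theorem dirDeriv_clm_comp {F' : Type*} [NormedAddCommGroup F'] [NormedSpace ℝ F'] (L : F →L[ℝ] F')
    (hf : ContMDiff I₂ 𝓘(ℝ, F) ∞ f) (w : TangentSpace I₂ y) :
    dirDeriv I₂ (fun y ↦ L (f y)) y w = L (dirDeriv I₂ f y w) :=
  DFunLike.congr_fun (HasMFDerivAt.comp y (L.hasFDerivAt (x := f y)).hasMFDerivAt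
    (hf.mdifferentiableAt (x := y) (by simp)).hasMFDerivAt).mfderiv w

theorem dirDeriv_const_mul {f : M₂ → ℝ} (hf : ContMDiff I₂ 𝓘(ℝ, ℝ) ∞ f) (r : ℝ)
    (w : TangentSpace I₂ y) :
    dirDeriv I₂ (fun y ↦ r * f y) y w = r * dirDeriv I₂ f y w :=
  dirDeriv_clm_comp (r • ContinuousLinearMap.id ℝ ℝ) hf w

end DirDeriv

theorem AlgebroidData.anchorDeriv_eq_dirDeriv (A : AlgebroidData I₂ V₂) (s : Π y, V₂ y)
    (f : M₂ → ℝ) (y : M₂) :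
    A.anchorDeriv s f y = dirDeriv I₂ f y (A.anchor y (s y)) :=
  rfl

theorem fiberDeriv_eq_dirDeriv (u : M₂ → V₁ x) (w : TangentSpace I₂ y) :
    fiberDeriv F₁ I₂ x u y w = (VectorBundle.continuousLinearEquivAt ℝ F₁ V₁ x).symm
      (dirDeriv I₂ (fun y ↦ VectorBundle.continuousLinearEquivAt ℝ F₁ V₁ x (u y)) y w) :=
  rfl

/-- The chain rule for L composed with the inverse of the model identification; the identification
then disappears from the result. -/
theorem dirDeriv_clm_fiber {F : Type*} [NormedAddCommGroup F] [NormedSpace ℝ F]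
    (hu : IsSmoothToFiber F₁ I₂ x u) (L : V₁ x →L[ℝ] F) (w : TangentSpace I₂ y) :
    dirDeriv I₂ (fun y ↦ L (u y)) y w = L (fiberDeriv F₁ I₂ x u y w) := by
  have h := dirDeriv_clm_comp (L ∘L ((VectorBundle.continuousLinearEquivAt ℝ F₁ V₁ x).symm :
    F₁ →L[ℝ] V₁ x)) hu w
  simp only [ContinuousLinearMap.comp_apply, ContinuousLinearEquiv.coe_coe,
    ContinuousLinearEquiv.symm_apply_apply] at h
  rw [h, fiberDeriv_eq_dirDeriv]

theorem fiberDeriv_endo (hu : IsSmoothToFiber F₁ I₂ x u) (L : V₁ x →L[ℝ] V₁ x)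
    (w : TangentSpace I₂ y) :
    fiberDeriv F₁ I₂ x (fun y ↦ L (u y)) y w = L (fiberDeriv F₁ I₂ x u y w) := by
  rw [fiberDeriv_eq_dirDeriv, ContinuousLinearEquiv.symm_apply_eq]
  exact dirDeriv_clm_fiber hu
    (((VectorBundle.continuousLinearEquivAt ℝ F₁ V₁ x) : V₁ x →L[ℝ] F₁) ∘L L) w

/-- This is the shape of a component of J s along the opposite factor: there the endomorphism and
the Reeb vector are constant, and only the section and the scalar coefficient vary. -/
theorem fiberDeriv_endo_sub_smul_const (hu : IsSmoothToFiber F₁ I₂ x u) (L : V₁ x →L[ℝ] V₁ x)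
    {f : M₂ → ℝ} (hf : ContMDiff I₂ 𝓘(ℝ, ℝ) ∞ f) (v : V₁ x) (w : TangentSpace I₂ y) :
    fiberDeriv F₁ I₂ x (fun y ↦ L (u y) - f y • v) y w
      = L (fiberDeriv F₁ I₂ x u y w) - dirDeriv I₂ f y w • v := by
  rw [← fiberDeriv_endo hu, fiberDeriv_eq_dirDeriv, ContinuousLinearEquiv.symm_apply_eq, map_sub,
    map_smul, fiberDeriv_eq_dirDeriv, ContinuousLinearEquiv.apply_symm_apply]
  simp only [map_sub, map_smul]
  rw [dirDeriv_sub (hu.endo L) 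
    (show ContMDiff I₂ 𝓘(ℝ, F₁) ∞ fun y ↦
      f y • VectorBundle.continuousLinearEquivAt ℝ F₁ V₁ x v from hf.smul contMDiff_const)]
  congr 1
  exact dirDeriv_clm_comp ((ContinuousLinearMap.id ℝ ℝ).smulRight
    (VectorBundle.continuousLinearEquivAt ℝ F₁ V₁ x v)) hf w

theorem fiberDeriv_sub_dir (u : M₂ → V₁ x) (w w' : TangentSpace I₂ y) :
    fiberDeriv F₁ I₂ x u y (w - w') = fiberDeriv F₁ I₂ x u y w - fiberDeriv F₁ I₂ x u y w' := by
  simp only [fiberDeriv_eq_dirDeriv, dirDeriv_sub_dir, map_sub]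

theorem fiberDeriv_smul_dir (u : M₂ → V₁ x) (c : ℝ) (w : TangentSpace I₂ y) :
    fiberDeriv F₁ I₂ x u y (c • w) = c • fiberDeriv F₁ I₂ x u y w := by
  simp only [fiberDeriv_eq_dirDeriv, dirDeriv_smul_dir, map_smul]

variable (F₁) in
/-- The first component of the bracket of the direct product of two algebroids, on a pair of
sections given by their components. -/
def AlgebroidData.bracketFst (A₁ : AlgebroidData I₁ V₁) (A₂ : AlgebroidData I₂ V₂)
    (a : Π x, M₂ → V₁ x) (b : M₁ → Π y, V₂ y) (c : Π x, M₂ → V₁ x) (d : M₁ → Π y, V₂ y)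
    (x : M₁) (y : M₂) : V₁ x :=
  A₁.bracket (fun x ↦ a x y) (fun x ↦ c x y) x
    + fiberDeriv F₁ I₂ x (c x) y (A₂.anchor y (b x y))
    - fiberDeriv F₁ I₂ x (a x) y (A₂.anchor y (d x y))

variable [∀ x, IsTopologicalAddGroup (V₁ x)] [∀ x, ContinuousSMul ℝ (V₁ x)]
  [∀ x, IsTopologicalAddGroup (V₂ x)] [∀ x, ContinuousSMul ℝ (V₂ x)]
  [IsManifold I₁ ∞ M₁] [IsManifold I₂ ∞ M₂]

/-- The first component of the Nijenhuis tensor of `(v, w) ↦ (F₁ v - ε η₂(w) ξ₁, F₂ w + ε η₁(v) ξ₂)`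
with `ε = ±1`, in terms of the structure tensors of the two factors. -/
theorem nijenhuis_fst_formula (A₁ : LieAlgebroid I₁ F₁ V₁) (A₂ : LieAlgebroid I₂ F₂ V₂)
    (S₁ : AlmostContactRiemannianStructure I₁ F₁ V₁)
    (S₂ : AlmostContactRiemannianStructure I₂ F₂ V₂) {ε : ℝ} (hε : ε * ε = 1)
    {a c : Π x, M₂ → V₁ x} {b d : M₁ → Π y, V₂ y} {x : M₁} {y : M₂}
    (ha : IsSmoothSection I₁ F₁ fun x ↦ a x y) (ha' : IsSmoothToFiber F₁ I₂ x (a x))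
    (hc : IsSmoothSection I₁ F₁ fun x ↦ c x y) (hc' : IsSmoothToFiber F₁ I₂ x (c x))
    (hb : IsSmoothSection I₂ F₂ (b x)) (hb' : IsSmoothToFiber F₂ I₁ y fun x ↦ b x y)
    (hd : IsSmoothSection I₂ F₂ (d x)) (hd' : IsSmoothToFiber F₂ I₁ y fun x ↦ d x y)
    {Ja Jc : Π x, M₂ → V₁ x} {Jb Jd : M₁ → Π y, V₂ y}
    (hJa : ∀ x y, Ja x y = S₁.endo x (a x y) - (ε * S₂.form y (b x y)) • S₁.reeb x)
    (hJc : ∀ x y, Jc x y = S₁.endo x (c x y) - (ε * S₂.form y (d x y)) • S₁.reeb x)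
    (hJb : ∀ x y, Jb x y = S₂.endo y (b x y) - (-ε * S₁.form x (a x y)) • S₂.reeb y)
    (hJd : ∀ x y, Jd x y = S₂.endo y (d x y) - (-ε * S₁.form x (c x y)) • S₂.reeb y) :
    A₁.bracketFst F₁ A₂.toAlgebroidData Ja Jb Jc Jd x y
      - (S₁.endo x (A₁.bracketFst F₁ A₂.toAlgebroidData Ja Jb c d x y)
        - (ε * S₂.form y (A₂.bracketFst F₂ A₁.toAlgebroidData (fun y x ↦ Jb x y)
            (fun y x ↦ Ja x y) (fun y x ↦ d x y) (fun y x ↦ c x y) y x)) • S₁.reeb x)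
      - (S₁.endo x (A₁.bracketFst F₁ A₂.toAlgebroidData a b Jc Jd x y)
        - (ε * S₂.form y (A₂.bracketFst F₂ A₁.toAlgebroidData (fun y x ↦ b x y)
            (fun y x ↦ a x y) (fun y x ↦ Jd x y) (fun y x ↦ Jc x y) y x)) • S₁.reeb x)
      - A₁.bracketFst F₁ A₂.toAlgebroidData a b c d x y
    = S₁.normality A₁.toAlgebroidData (fun x ↦ a x y) (fun x ↦ c x y) x
      - (ε * S₂.form y (d x y)) • S₁.lieEndo A₁.toAlgebroidData (fun x ↦ a x y) x
      + (ε * S₂.form y (b x y)) • S₁.lieEndo A₁.toAlgebroidData (fun x ↦ c x y) x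
      - (ε * S₂.twistForm A₂.toAlgebroidData (b x) (d x) y
        + S₁.form x (a x y) * S₂.lieForm A₂.toAlgebroidData (d x) y
        - S₁.form x (c x y) * S₂.lieForm A₂.toAlgebroidData (b x) y) • S₁.reeb x := by
  have hJa2 : Ja x = fun y ↦ S₁.endo x (a x y) - (ε * S₂.form y (b x y)) • S₁.reeb x :=
    funext fun y ↦ hJa x y
  have hJc2 : Jc x = fun y ↦ S₁.endo x (c x y) - (ε * S₂.form y (d x y)) • S₁.reeb x :=
    funext fun y ↦ hJc x y
  have hFa := ha.endo S₁.smooth_endo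
  have hFc := hc.endo S₁.smooth_endo
  have hFb := hb.endo S₂.smooth_endo
  have hFd := hd.endo S₂.smooth_endo
  have hξ₁ := S₁.smooth_reeb
  have hξ₂ := S₂.smooth_reeb
  -- the functions `η₁(a)`, `η₁(c)`, `η₂(b)`, `η₂(d)` along the slices
  have hα₂ := ha'.clm_apply (S₁.form x)
  have hγ₂ := hc'.clm_apply (S₁.form x)
  have hβ₁ := hb'.clm_apply (S₂.form y)
  have hδ₁ := hd'.clm_apply (S₂.form y)
  have hα₁ := ha.form S₁.smooth_form
  have hγ₁ := hc.form S₁.smooth_form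
  have hβ₂ := hb.form S₂.smooth_form
  have hδ₂ := hd.form S₂.smooth_form
  have cm₁ : ∀ (r : ℝ) {f : M₁ → ℝ}, ContMDiff I₁ 𝓘(ℝ, ℝ) ∞ f →
      ContMDiff I₁ 𝓘(ℝ, ℝ) ∞ (fun x ↦ r * f x) := fun r f hf ↦ contMDiff_const.mul hf
  have cm₂ : ∀ (r : ℝ) {f : M₂ → ℝ}, ContMDiff I₂ 𝓘(ℝ, ℝ) ∞ f →
      ContMDiff I₂ 𝓘(ℝ, ℝ) ∞ (fun x ↦ r * f x) := fun r f hf ↦ contMDiff_const.mul hf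
  have eα₁ : ∀ w, dirDeriv I₁ (fun x ↦ -ε * S₁.form x (a x y)) x w
      = -ε * dirDeriv I₁ (fun x ↦ S₁.form x (a x y)) x w := dirDeriv_const_mul hα₁ _
  have eγ₁ : ∀ w, dirDeriv I₁ (fun x ↦ -ε * S₁.form x (c x y)) x w
      = -ε * dirDeriv I₁ (fun x ↦ S₁.form x (c x y)) x w := dirDeriv_const_mul hγ₁ _
  have eβ₂ : ∀ w, dirDeriv I₂ (fun y ↦ ε * S₂.form y (b x y)) y w
      = ε * dirDeriv I₂ (fun y ↦ S₂.form y (b x y)) y w := dirDeriv_const_mul hβ₂ _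
  have eδ₂ : ∀ w, dirDeriv I₂ (fun y ↦ ε * S₂.form y (d x y)) y w
      = ε * dirDeriv I₂ (fun y ↦ S₂.form y (d x y)) y w := dirDeriv_const_mul hδ₂ _
  -- Along the opposite factor the one-form is constant, so the derivative passes through it; along
  -- its own factor, as above, only the constant ε comes out.
  have eα₂ : ∀ w, dirDeriv I₂ (fun y ↦ -ε * S₁.form x (a x y)) y w
      = -ε * S₁.form x (fiberDeriv F₁ I₂ x (a x) y w) := fun w ↦ by
    rw [dirDeriv_const_mul hα₂, dirDeriv_clm_fiber ha']
  have eγ₂ : ∀ w, dirDeriv I₂ (fun y ↦ -ε * S₁.form x (c x y)) y w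
      = -ε * S₁.form x (fiberDeriv F₁ I₂ x (c x) y w) := fun w ↦ by
    rw [dirDeriv_const_mul hγ₂, dirDeriv_clm_fiber hc']
  have eβ₁ : ∀ w, dirDeriv I₁ (fun x ↦ ε * S₂.form y (b x y)) x w
      = ε * S₂.form y (fiberDeriv F₂ I₁ y (fun x ↦ b x y) x w) := fun w ↦ by
    rw [dirDeriv_const_mul hβ₁, dirDeriv_clm_fiber hb']
  have eδ₁ : ∀ w, dirDeriv I₁ (fun x ↦ ε * S₂.form y (d x y)) x w
      = ε * S₂.form y (fiberDeriv F₂ I₁ y (fun x ↦ d x y) x w) := fun w ↦ by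
    rw [dirDeriv_const_mul hδ₁, dirDeriv_clm_fiber hd']
  have sβ := cm₁ ε hβ₁
  have sδ := cm₁ ε hδ₁
  have sα := cm₂ (-ε) hα₂
  have sγ := cm₂ (-ε) hγ₂
  rw [S₁.normality_eq]
  simp only [AlgebroidData.bracketFst, AlmostContactRiemannianStructure.lieEndo,
    AlmostContactRiemannianStructure.lieForm, AlmostContactRiemannianStructure.twistForm]
  simp only [hJa2, hJc2, hJa, hJb, hJc, hJd]
  -- Leibniz expansion of all brackets containing a component of J; skew-symmetry then brings the
  -- brackets with ξ to the common form [·, ξ].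
  rw [A₁.bracket_sub_smul_left hFa (hFc.sub (.smul sδ hξ₁)) hξ₁ sβ,
    A₁.bracket_sub_smul_right hFa hFc hξ₁ sδ, A₁.bracket_sub_smul_right hξ₁ hFc hξ₁ sδ,
    A₁.bracket_self hξ₁, A₁.bracket_sub_smul_left hFa hc hξ₁ sβ,
    A₁.bracket_sub_smul_right ha hFc hξ₁ sδ,
    A₂.bracket_sub_smul_left hFb hd hξ₂ sα, A₂.bracket_sub_smul_right hb hFd hξ₂ sγ,
    A₁.bracket_skew_apply hξ₁ hFc, A₁.bracket_skew_apply hξ₁ hc, A₂.bracket_skew_apply hξ₂ hd,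
    A₂.bracket_skew_apply hξ₂ hb]
  simp only [AlgebroidData.anchorDeriv_sub_smul]
  simp only [AlgebroidData.anchorDeriv_eq_dirDeriv,
    fiberDeriv_endo_sub_smul_const hc' (S₁.endo x) (cm₂ ε hδ₂),
    fiberDeriv_endo_sub_smul_const ha' (S₁.endo x) (cm₂ ε hβ₂),
    fiberDeriv_endo_sub_smul_const hd' (S₂.endo y) (cm₁ (-ε) hγ₁),
    fiberDeriv_endo_sub_smul_const hb' (S₂.endo y) (cm₁ (-ε) hα₁),
    fiberDeriv_sub_dir, fiberDeriv_smul_dir, dirDeriv_sub_dir, dirDeriv_smul_dir,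
    eα₁, eα₂, eβ₁, eβ₂, eγ₁, eγ₂, eδ₁, eδ₂, map_sub, map_smul, map_add, map_neg,
    S₁.endo_endo, S₁.endo_reeb, S₂.form_reeb, S₂.form_endo, smul_eq_mul]
  -- The relation ε² = 1 is needed for the cancellation: F₁² + 1 applied to a fibre derivative of c
  -- leaves a multiple of ξ₁, offset with factor ε² by the derivative of the coefficient η₁(c) in
  -- the other component. Fixing ε makes the identity one of modules.
  rcases mul_self_eq_one_iff.1 hε with rfl | rfl
  · module
  · module

end Slices

/-! ### The product structure: algebra, smoothness, integrability -/

section Product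

variable {EM₁ : Type*} [NormedAddCommGroup EM₁] [NormedSpace ℝ EM₁]
  {H₁ : Type*} [TopologicalSpace H₁] {I₁ : ModelWithCorners ℝ EM₁ H₁}
  {M₁ : Type*} [TopologicalSpace M₁] [ChartedSpace H₁ M₁]
  {F₁ : Type*} [NormedAddCommGroup F₁] [NormedSpace ℝ F₁]
  {V₁ : M₁ → Type*} [TopologicalSpace (Bundle.TotalSpace F₁ V₁)]
  [∀ x, TopologicalSpace (V₁ x)] [∀ x, AddCommGroup (V₁ x)] [∀ x, Module ℝ (V₁ x)]
  [FiberBundle F₁ V₁] [VectorBundle ℝ F₁ V₁]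
  {EM₂ : Type*} [NormedAddCommGroup EM₂] [NormedSpace ℝ EM₂]
  {H₂ : Type*} [TopologicalSpace H₂] {I₂ : ModelWithCorners ℝ EM₂ H₂}
  {M₂ : Type*} [TopologicalSpace M₂] [ChartedSpace H₂ M₂]
  {F₂ : Type*} [NormedAddCommGroup F₂] [NormedSpace ℝ F₂]
  {V₂ : M₂ → Type*} [TopologicalSpace (Bundle.TotalSpace F₂ V₂)]
  [∀ x, TopologicalSpace (V₂ x)] [∀ x, AddCommGroup (V₂ x)] [∀ x, Module ℝ (V₂ x)]
  [FiberBundle F₂ V₂] [VectorBundle ℝ F₂ V₂]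

namespace IsSmoothSection

variable {s : Π p : M₁ × M₂, ProdBundle V₁ V₂ p}

/-- Along the slice the base point x is constant, so the local coordinate of the section is exactly
the identification used by `fiberDeriv`. -/
theorem toFiber_fst (hs : IsSmoothSection (I₁.prod I₂) (F₁ × F₂) s) (x : M₁) :
    IsSmoothToFiber F₁ I₂ x (fun y ↦ (s (x, y)).1) := fun y ↦
  (Bundle.contMDiffAt_totalSpace.1
    (hs.fst_along (b := fun y ↦ (x, y)) (contMDiff_const.prodMk contMDiff_id) y)).2

theorem toFiber_snd (hs : IsSmoothSection (I₁.prod I₂) (F₁ × F₂) s) (y : M₂) :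
    IsSmoothToFiber F₂ I₁ y (fun x ↦ (s (x, y)).2) := fun x ↦
  (Bundle.contMDiffAt_totalSpace.1
    (hs.snd_along (b := fun x ↦ (x, y)) (contMDiff_id.prodMk contMDiff_const) x)).2

end IsSmoothSection

variable [∀ x, IsTopologicalAddGroup (V₁ x)] [∀ x, ContinuousSMul ℝ (V₁ x)]
  [∀ x, IsTopologicalAddGroup (V₂ x)] [∀ x, ContinuousSMul ℝ (V₂ x)]

namespace AlmostContactRiemannianStructure

variable (S₁ : AlmostContactRiemannianStructure I₁ F₁ V₁)
  (S₂ : AlmostContactRiemannianStructure I₂ F₂ V₂)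

theorem prodEndo_apply (p : M₁ × M₂) (v : ProdBundle V₁ V₂ p) :
    S₁.prodEndo S₂ p v = (S₁.endo p.1 v.1 - S₂.form p.2 v.2 • S₁.reeb p.1,
      S₂.endo p.2 v.2 + S₁.form p.1 v.1 • S₂.reeb p.2) :=
  rfl

theorem prodMetric_apply (p : M₁ × M₂) (v w : ProdBundle V₁ V₂ p) :
    S₁.prodMetric S₂ p v w = S₁.metric.inner p.1 v.1 w.1 + S₂.metric.inner p.2 v.2 w.2 :=
  rfl

theorem prodEndo_prodEndo (p : M₁ × M₂) (v : ProdBundle V₁ V₂ p) :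
    S₁.prodEndo S₂ p (S₁.prodEndo S₂ p v) = -v := by
  simp only [prodEndo_apply, map_sub, map_add, map_smul, S₁.endo_endo, S₂.endo_endo, S₁.endo_reeb,
    S₂.endo_reeb, S₁.form_endo, S₂.form_endo, S₁.form_reeb, S₂.form_reeb, smul_eq_mul]
  ext
  · simp only [Prod.fst_neg]
    module
  · simp only [Prod.snd_neg]
    module

theorem prodMetric_prodEndo (p : M₁ × M₂) (v w : ProdBundle V₁ V₂ p) :
    S₁.prodMetric S₂ p (S₁.prodEndo S₂ p v) (S₁.prodEndo S₂ p w) = S₁.prodMetric S₂ p v w := by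
  simp only [prodEndo_apply, prodMetric_apply, map_sub, map_add, map_smul,
    _root_.sub_apply, _root_.add_apply, _root_.smul_apply,
    S₁.metric_endo, S₂.metric_endo, S₁.metric_endo_reeb, S₂.metric_endo_reeb,
    S₁.metric_reeb_endo, S₂.metric_reeb_endo, S₁.metric_reeb_reeb, S₂.metric_reeb_reeb,
    smul_eq_mul]
  ring

variable [IsManifold I₁ ∞ M₁] [IsManifold I₂ ∞ M₂]

section Smooth

variable [FiniteDimensional ℝ F₁] [FiniteDimensional ℝ F₂]
  [ContMDiffVectorBundle ∞ F₁ V₁ I₁] [ContMDiffVectorBundle ∞ F₂ V₂ I₂]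

theorem smooth_prodEndo : IsSmoothEndo (I₁.prod I₂) (F₁ × F₂) (S₁.prodEndo S₂) := by
  intro p
  refine contMDiffAt_hom_of_apply fun s hs ↦ ?_
  obtain ⟨h₁, h₂⟩ := ProdBundle.contMDiffAt_iff.1 hs
  have hE₁ := ContMDiffAt.clm_bundle_apply (b := Prod.fst) (ϕ := fun p ↦ S₁.endo p.1)
    (ContMDiffAt.comp p (S₁.smooth_endo p.1) contMDiffAt_fst) h₁
  have hE₂ := ContMDiffAt.clm_bundle_apply (b := Prod.snd) (ϕ := fun p ↦ S₂.endo p.2)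
    (ContMDiffAt.comp p (S₂.smooth_endo p.2) contMDiffAt_snd) h₂
  have hη₁ := (Bundle.contMDiffAt_totalSpace.1 (ContMDiffAt.clm_bundle_apply (F₂ := ℝ)
    (E₂ := Bundle.Trivial M₁ ℝ) (b := Prod.fst) (ϕ := fun p ↦ S₁.form p.1)
    (ContMDiffAt.comp p (S₁.smooth_form p.1) contMDiffAt_fst) h₁)).2
  have hη₂ := (Bundle.contMDiffAt_totalSpace.1 (ContMDiffAt.clm_bundle_apply (F₂ := ℝ)
    (E₂ := Bundle.Trivial M₂ ℝ) (b := Prod.snd) (ϕ := fun p ↦ S₂.form p.2)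
    (ContMDiffAt.comp p (S₂.smooth_form p.2) contMDiffAt_snd) h₂)).2
  exact ProdBundle.contMDiffAt_iff.2
    ⟨hE₁.sub_along (.smul_along hη₂ (ContMDiffAt.comp p (S₁.smooth_reeb p.1) contMDiffAt_fst)),
      hE₂.add_along (.smul_along hη₁ (ContMDiffAt.comp p (S₂.smooth_reeb p.2) contMDiffAt_snd))⟩

theorem smooth_prodMetric :
    ContMDiff (I₁.prod I₂) ((I₁.prod I₂).prod 𝓘(ℝ, F₁ × F₂ →L[ℝ] F₁ × F₂ →L[ℝ] ℝ)) ∞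
      (fun p ↦ Bundle.TotalSpace.mk' (F₁ × F₂ →L[ℝ] F₁ × F₂ →L[ℝ] ℝ)
        (E := fun p ↦ ProdBundle V₁ V₂ p →L[ℝ] ProdBundle V₁ V₂ p →L[ℝ] ℝ)
        p (S₁.prodMetric S₂ p)) := by
  intro p
  refine contMDiffAt_hom_of_apply (F := F₁ × F₂) (V := ProdBundle V₁ V₂)
    (F' := F₁ × F₂ →L[ℝ] ℝ) (V' := fun p ↦ ProdBundle V₁ V₂ p →L[ℝ] ℝ) fun s hs ↦ ?_
  -- The metric is curried, so the test on sections is applied once for each argument.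
  refine contMDiffAt_hom_of_apply (F := F₁ × F₂) (V := ProdBundle V₁ V₂)
    (F' := ℝ) (V' := Bundle.Trivial (M₁ × M₂) ℝ) fun t ht ↦ ?_
  obtain ⟨h₁, h₂⟩ := ProdBundle.contMDiffAt_iff.1 hs
  obtain ⟨k₁, k₂⟩ := ProdBundle.contMDiffAt_iff.1 ht
  have hg₁ := (Bundle.contMDiffAt_totalSpace.1 (ContMDiffAt.clm_bundle_apply₂ (F₃ := ℝ)
    (E₃ := Bundle.Trivial M₁ ℝ) (b := Prod.fst) (ψ := fun p ↦ S₁.metric.inner p.1)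
    (ContMDiffAt.comp p (S₁.metric.contMDiff p.1) contMDiffAt_fst) h₁ k₁)).2
  have hg₂ := (Bundle.contMDiffAt_totalSpace.1 (ContMDiffAt.clm_bundle_apply₂ (F₃ := ℝ)
    (E₃ := Bundle.Trivial M₂ ℝ) (b := Prod.snd) (ψ := fun p ↦ S₂.metric.inner p.2)
    (ContMDiffAt.comp p (S₂.metric.contMDiff p.2) contMDiffAt_snd) h₂ k₂)).2
  exact Bundle.contMDiffAt_totalSpace.2 ⟨contMDiffAt_id, hg₁.add hg₂⟩

theorem isAlmostHermitian_prod :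
    IsAlmostHermitian (I₁.prod I₂) (F₁ × F₂) (S₁.prodEndo S₂) (S₁.prodMetric S₂) where
  smooth_endo := S₁.smooth_prodEndo S₂
  riemannian := by
    refine ⟨⟨S₁.prodMetric S₂, fun p v w ↦ ?_, fun p v hv ↦ ?_, fun p ↦ ?_,
      S₁.smooth_prodMetric S₂⟩, fun p ↦ rfl⟩
    · simp only [prodMetric_apply, S₁.metric.symm p.1 v.1, S₂.metric.symm p.2 v.2]
    · rw [prodMetric_apply]
      by_cases h : v.1 = 0
      · have h' : v.2 ≠ 0 := fun h' ↦ hv (Prod.ext h h')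
        exact add_pos_of_nonneg_of_pos (S₁.inner_self_nonneg _ _) (S₂.metric.pos _ _ h')
      · exact add_pos_of_pos_of_nonneg (S₁.metric.pos _ _ h) (S₂.inner_self_nonneg _ _)
    -- The unit ball of the product metric lies in the sum of the two factor balls, embedded by the
    -- inclusions; images under continuous linear maps and sums keep boundedness.
    · refine (((S₁.metric.isVonNBounded p.1).image
        (ContinuousLinearMap.inl ℝ (V₁ p.1) (V₂ p.2))).add
        ((S₂.metric.isVonNBounded p.2).image
        (ContinuousLinearMap.inr ℝ (V₁ p.1) (V₂ p.2)))).subset fun v hv ↦ ?_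
      rw [Set.mem_ofPred_eq, prodMetric_apply] at hv
      have h₁ := S₁.inner_self_nonneg p.1 v.1
      have h₂ := S₂.inner_self_nonneg p.2 v.2
      have k₁ : v.1 ∈ {v | S₁.metric.inner p.1 v v < 1} := by
        rw [Set.mem_ofPred_eq]
        linarith
      have k₂ : v.2 ∈ {v | S₂.metric.inner p.2 v v < 1} := by
        rw [Set.mem_ofPred_eq]
        linarith
      exact Set.mem_add.2 ⟨_, ⟨v.1, k₁, rfl⟩, _, ⟨v.2, k₂, rfl⟩, by simp⟩
  endo_endo := S₁.prodEndo_prodEndo S₂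
  metric_endo := S₁.prodMetric_prodEndo S₂

end Smooth

variable (A₁ : LieAlgebroid I₁ F₁ V₁) (A₂ : LieAlgebroid I₂ F₂ V₂)
  {s t : Π p : M₁ × M₂, ProdBundle V₁ V₂ p}

/-- The case ε = 1 of the general formula, with J² = -1 turning the last term of the Nijenhuis
tensor into -[s, t]. -/
theorem nijenhuis_prodEndo_fst (hs : IsSmoothSection (I₁.prod I₂) (F₁ × F₂) s)
    (ht : IsSmoothSection (I₁.prod I₂) (F₁ × F₂) t) (x : M₁) (y : M₂) :
    ((A₁.toAlgebroidData.prod F₁ F₂ A₂.toAlgebroidData).nijenhuis (S₁.prodEndo S₂) s t (x, y)).1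
    = S₁.normality A₁.toAlgebroidData (fun x ↦ (s (x, y)).1) (fun x ↦ (t (x, y)).1) x
      - S₂.form y (t (x, y)).2 • S₁.lieEndo A₁.toAlgebroidData (fun x ↦ (s (x, y)).1) x
      + S₂.form y (s (x, y)).2 • S₁.lieEndo A₁.toAlgebroidData (fun x ↦ (t (x, y)).1) x
      - (S₂.twistForm A₂.toAlgebroidData (fun y ↦ (s (x, y)).2) (fun y ↦ (t (x, y)).2) y
        + S₁.form x (s (x, y)).1 * S₂.lieForm A₂.toAlgebroidData (fun y ↦ (t (x, y)).2) y
        - S₁.form x (t (x, y)).1 * S₂.lieForm A₂.toAlgebroidData (fun y ↦ (s (x, y)).2) y)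
          • S₁.reeb x := by
  have h := nijenhuis_fst_formula A₁ A₂ S₁ S₂ (one_mul (1 : ℝ)) (hs.slice_fst y) (hs.toFiber_fst x)
    (ht.slice_fst y) (ht.toFiber_fst x) (hs.slice_snd x) (hs.toFiber_snd y) (ht.slice_snd x)
    (ht.toFiber_snd y)
    (a := fun x y ↦ (s (x, y)).1) (b := fun x y ↦ (s (x, y)).2)
    (c := fun x y ↦ (t (x, y)).1) (d := fun x y ↦ (t (x, y)).2)
    (Ja := fun x y ↦ (S₁.prodEndo S₂ (x, y) (s (x, y))).1)
    (Jc := fun x y ↦ (S₁.prodEndo S₂ (x, y) (t (x, y))).1)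
    (Jb := fun x y ↦ (S₁.prodEndo S₂ (x, y) (s (x, y))).2)
    (Jd := fun x y ↦ (S₁.prodEndo S₂ (x, y) (t (x, y))).2)
    (fun x y ↦ by simp [prodEndo_apply]) (fun x y ↦ by simp [prodEndo_apply])
    (fun x y ↦ by simp [prodEndo_apply]) (fun x y ↦ by simp [prodEndo_apply])
  simp only [one_mul] at h
  rw [← h, AlgebroidData.nijenhuis, prodEndo_prodEndo, ← sub_eq_add_neg]
  rfl

/-- With the factors exchanged, the mixed terms of J change sign, so this is the case ε = -1. -/
theorem nijenhuis_prodEndo_snd (hs : IsSmoothSection (I₁.prod I₂) (F₁ × F₂) s)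
    (ht : IsSmoothSection (I₁.prod I₂) (F₁ × F₂) t) (x : M₁) (y : M₂) :
    ((A₁.toAlgebroidData.prod F₁ F₂ A₂.toAlgebroidData).nijenhuis (S₁.prodEndo S₂) s t (x, y)).2
    = S₂.normality A₂.toAlgebroidData (fun y ↦ (s (x, y)).2) (fun y ↦ (t (x, y)).2) y
      + S₁.form x (t (x, y)).1 • S₂.lieEndo A₂.toAlgebroidData (fun y ↦ (s (x, y)).2) y
      - S₁.form x (s (x, y)).1 • S₂.lieEndo A₂.toAlgebroidData (fun y ↦ (t (x, y)).2) y
      + (S₁.twistForm A₁.toAlgebroidData (fun x ↦ (s (x, y)).1) (fun x ↦ (t (x, y)).1) x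
        - S₂.form y (s (x, y)).2 * S₁.lieForm A₁.toAlgebroidData (fun x ↦ (t (x, y)).1) x
        + S₂.form y (t (x, y)).2 * S₁.lieForm A₁.toAlgebroidData (fun x ↦ (s (x, y)).1) x)
          • S₂.reeb y := by
  have h := nijenhuis_fst_formula A₂ A₁ S₂ S₁ (ε := -1) (by norm_num) (hs.slice_snd x)
    (hs.toFiber_snd y) (ht.slice_snd x) (ht.toFiber_snd y) (hs.slice_fst y) (hs.toFiber_fst x)
    (ht.slice_fst y) (ht.toFiber_fst x)
    (a := fun y x ↦ (s (x, y)).2) (b := fun y x ↦ (s (x, y)).1)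
    (c := fun y x ↦ (t (x, y)).2) (d := fun y x ↦ (t (x, y)).1)
    (Ja := fun y x ↦ (S₁.prodEndo S₂ (x, y) (s (x, y))).2)
    (Jc := fun y x ↦ (S₁.prodEndo S₂ (x, y) (t (x, y))).2)
    (Jb := fun y x ↦ (S₁.prodEndo S₂ (x, y) (s (x, y))).1)
    (Jd := fun y x ↦ (S₁.prodEndo S₂ (x, y) (t (x, y))).1)
    (fun x y ↦ by simp [prodEndo_apply]) (fun x y ↦ by simp [prodEndo_apply])
    (fun x y ↦ by simp [prodEndo_apply]) (fun x y ↦ by simp [prodEndo_apply])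
  simp only [neg_mul, one_mul, neg_smul, sub_neg_eq_add] at h
  rw [AlgebroidData.nijenhuis, prodEndo_prodEndo, ← sub_eq_add_neg]
  refine Eq.trans h ?_
  module

theorem nijenhuis_prodEndo_eq_zero_iff [Nonempty M₁] [Nonempty M₂] :
    (∀ s t, IsSmoothSection (I₁.prod I₂) (F₁ × F₂) s → IsSmoothSection (I₁.prod I₂) (F₁ × F₂) t →
      ∀ p,
        (A₁.toAlgebroidData.prod F₁ F₂ A₂.toAlgebroidData).nijenhuis (S₁.prodEndo S₂) s t p = 0) ↔
    S₁.IsNormal A₁.toAlgebroidData ∧ S₂.IsNormal A₂.toAlgebroidData := by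
  refine ⟨fun h ↦ ⟨fun s t hs ht x ↦ ?_, fun s t hs ht y ↦ ?_⟩, fun ⟨n₁, n₂⟩ s t hs ht p ↦ ?_⟩
  -- Any y serves: on s ⊕ 0 and t ⊕ 0 every term except the normality tensor of the first factor is
  -- zero.
  · obtain ⟨y⟩ := ‹Nonempty M₂›
    have hs' := hs.prod (IsSmoothSection.zero (I := I₂) (F := F₂) (V := V₂))
    have ht' := ht.prod (IsSmoothSection.zero (I := I₂) (F := F₂) (V := V₂))
    have h₁ := S₁.nijenhuis_prodEndo_fst S₂ A₁ A₂ hs' ht' x y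
    rw [h _ _ hs' ht'] at h₁
    change S₁.normality A₁.toAlgebroidData s t x = 0
    simpa [S₂.lieForm_zero, S₂.twistForm_zero] using h₁.symm
  · obtain ⟨x⟩ := ‹Nonempty M₁›
    have hs' := (IsSmoothSection.zero (I := I₁) (F := F₁) (V := V₁)).prod hs
    have ht' := (IsSmoothSection.zero (I := I₁) (F := F₁) (V := V₁)).prod ht
    have h₁ := S₁.nijenhuis_prodEndo_snd S₂ A₁ A₂ hs' ht' x y
    rw [h _ _ hs' ht'] at h₁
    change S₂.normality A₂.toAlgebroidData s t y = 0
    simpa [S₁.lieForm_zero, S₁.twistForm_zero] using h₁.symm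
  · obtain ⟨x, y⟩ := p
    have hs₁ := hs.slice_fst y
    have ht₁ := ht.slice_fst y
    have hs₂ := hs.slice_snd x
    have ht₂ := ht.slice_snd x
    refine Prod.ext ?_ ?_
    · rw [nijenhuis_prodEndo_fst S₁ S₂ A₁ A₂ hs ht, normality, n₁ _ _ hs₁ ht₁,
        n₁.lieEndo_eq_zero hs₁, n₁.lieEndo_eq_zero ht₁, n₂.twistForm_eq_zero hs₂ ht₂,
        n₂.lieForm_eq_zero hs₂, n₂.lieForm_eq_zero ht₂]
      simp
    · rw [nijenhuis_prodEndo_snd S₁ S₂ A₁ A₂ hs ht, normality, n₂ _ _ hs₂ ht₂,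
        n₂.lieEndo_eq_zero hs₂, n₂.lieEndo_eq_zero ht₂, n₁.twistForm_eq_zero hs₁ ht₁,
        n₁.lieForm_eq_zero hs₁, n₁.lieForm_eq_zero ht₁]
      simp

end AlmostContactRiemannianStructure

end Product

end

theorem proposition3p3
    {EM₁ : Type*} [NormedAddCommGroup EM₁] [NormedSpace ℝ EM₁] [FiniteDimensional ℝ EM₁]
    {H₁ : Type*} [TopologicalSpace H₁] {I₁ : ModelWithCorners ℝ EM₁ H₁}
    {M₁ : Type*} [TopologicalSpace M₁] [ChartedSpace H₁ M₁] [IsManifold I₁ ∞ M₁]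
    [BoundarylessManifold I₁ M₁] [T2Space M₁] [SecondCountableTopology M₁] [Nonempty M₁]
    {F₁ : Type*} [NormedAddCommGroup F₁] [NormedSpace ℝ F₁] [FiniteDimensional ℝ F₁]
    {V₁ : M₁ → Type*} [TopologicalSpace (Bundle.TotalSpace F₁ V₁)]
    [∀ x, TopologicalSpace (V₁ x)] [∀ x, AddCommGroup (V₁ x)] [∀ x, Module ℝ (V₁ x)]
    [∀ x, IsTopologicalAddGroup (V₁ x)] [∀ x, ContinuousSMul ℝ (V₁ x)]
    [FiberBundle F₁ V₁] [VectorBundle ℝ F₁ V₁] [ContMDiffVectorBundle ∞ F₁ V₁ I₁]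
    {EM₂ : Type*} [NormedAddCommGroup EM₂] [NormedSpace ℝ EM₂] [FiniteDimensional ℝ EM₂]
    {H₂ : Type*} [TopologicalSpace H₂] {I₂ : ModelWithCorners ℝ EM₂ H₂}
    {M₂ : Type*} [TopologicalSpace M₂] [ChartedSpace H₂ M₂] [IsManifold I₂ ∞ M₂]
    [BoundarylessManifold I₂ M₂] [T2Space M₂] [SecondCountableTopology M₂] [Nonempty M₂]
    {F₂ : Type*} [NormedAddCommGroup F₂] [NormedSpace ℝ F₂] [FiniteDimensional ℝ F₂]
    {V₂ : M₂ → Type*} [TopologicalSpace (Bundle.TotalSpace F₂ V₂)]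
    [∀ x, TopologicalSpace (V₂ x)] [∀ x, AddCommGroup (V₂ x)] [∀ x, Module ℝ (V₂ x)]
    [∀ x, IsTopologicalAddGroup (V₂ x)] [∀ x, ContinuousSMul ℝ (V₂ x)]
    [FiberBundle F₂ V₂] [VectorBundle ℝ F₂ V₂] [ContMDiffVectorBundle ∞ F₂ V₂ I₂]
    (m₁ m₂ : ℕ) (hm₁ : Module.finrank ℝ F₁ = 2 * m₁ + 1) (hm₂ : Module.finrank ℝ F₂ = 2 * m₂ + 1)
    (A₁ : LieAlgebroid I₁ F₁ V₁) (A₂ : LieAlgebroid I₂ F₂ V₂)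
    (S₁ : AlmostContactRiemannianStructure I₁ F₁ V₁)
    (S₂ : AlmostContactRiemannianStructure I₂ F₂ V₂) :
    IsAlmostHermitian (I₁.prod I₂) (F₁ × F₂) (S₁.prodEndo S₂) (S₁.prodMetric S₂) ∧
      (IsHermitian (F₁ × F₂) (A₁.toAlgebroidData.prod F₁ F₂ A₂.toAlgebroidData)
          (S₁.prodEndo S₂) (S₁.prodMetric S₂) ↔
        S₁.IsNormal A₁.toAlgebroidData ∧ S₂.IsNormal A₂.toAlgebroidData) := by
  exact ⟨S₁.isAlmostHermitian_prod S₂, (and_iff_right (S₁.isAlmostHermitian_prod S₂)).trans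
    (S₁.nijenhuis_prodEndo_eq_zero_iff S₂ A₁ A₂)⟩
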